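/- Let $X$ be a non-empty proper CAT(0) space (that is, a geodesic metric space satisfying the Bruhat--Tits inequality $2d(m,x)^2\le d(c,x)^2+d(c',x)^2-\tfrac12 d(c,c')^2$ for all points $x,c,c'$ and every midpoint $m$ of a geodesic from $c$ to $c'$, in which closed balls are compact). Let $G=G_1\times\cdots\times G_n$ be any product of finitely many groups (no topology is assumed), and let $G$ act on $X$ by isometries. Let $\partial X$ be the boundary at infinity of $X$, i.e. the set of geodesic rays $[0,\infty)\to X$ modulo the relation of being at bounded distance from each other, with the induced $G$-action. Then at least one of the following holds: (1) $G$ has a fixed point in $\partial X$; (2) there is a non-empty closed convex $G$-invariant subset $Z\subseteq X$ which splits $G$-equivariantly and isometrically as a product of $G_i$-spaces: there are metric spaces $Z_1,\dots,Z_n$, where each $Z_i$ carries an action of $G_i$ by isometries, and a surjective isometry $\varphi$ from $Z$ onto $Z_1\times\cdots\times Z_n$ with the metric $d(z,z')^2=\sum_{i} d(z_i,z_i')^2$, such that $\varphi(gz)_i=g_i\,\varphi(z)_i$ for all $g=(g_1,\dots,g_n)\in G$, $z\in Z$ and all $i$. -/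

import Mathlib

open scoped NNReal

namespace CATZero

universe u v

section Geodesics

variable {X : Type u} [MetricSpace X]

/-- `σ` restricted to `[0, dist x y]` is a geodesic (i.e. isometric) segment from `x` to `y`. -/
structure IsGeodesicSegment (σ : ℝ → X) (x y : X) : Prop where
  isometric : ∀ s ∈ Set.Icc (0 : ℝ) (dist x y), ∀ t ∈ Set.Icc (0 : ℝ) (dist x y),
    dist (σ s) (σ t) = |s - t|
  source : σ 0 = x
  target : σ (dist x y) = y

/-- A subset of a metric space is (geodesically) convex if it contains every geodesic segment
joining any two of its points. -/
def IsConvex (A : Set X) : Prop :=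
  ∀ x ∈ A, ∀ y ∈ A, ∀ σ : ℝ → X, IsGeodesicSegment σ x y →
    ∀ t ∈ Set.Icc (0 : ℝ) (dist x y), σ t ∈ A

variable (X)

/-- A CAT(0) space: a geodesic metric space in which the midpoint `m` of any geodesic segment
from `c` to `c'` satisfies the Bruhat-Tits inequality
`2 d(m,x)² ≤ d(c',x)² + d(c,x)² - d(c',c)² / 2` for every point `x`. -/
structure IsCATZero : Prop where
  geodesic : ∀ x y : X, ∃ σ : ℝ → X, IsGeodesicSegment σ x y
  bruhat_tits : ∀ (x c c' : X) (σ : ℝ → X), IsGeodesicSegment σ c c' →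
    2 * dist (σ (dist c c' / 2)) x ^ 2 ≤
      dist c' x ^ 2 + dist c x ^ 2 - 1 / 2 * dist c' c ^ 2

/-- Geodesic rays: isometric maps `[0, ∞) → X`. -/
def GeodesicRay : Type u := {r : ℝ≥0 → X // Isometry r}

/-- Two rays are asymptotic if they remain at bounded distance from each other. -/
instance asymptotic : Setoid (GeodesicRay X) where
  r r₁ r₂ := ∃ C : ℝ, ∀ t : ℝ≥0, dist (r₁.1 t) (r₂.1 t) ≤ C
  iseqv :=
    { refl := fun r => ⟨0, fun t => (dist_self (r.1 t)).le⟩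
      symm := fun {r₁ r₂} ⟨C, h⟩ => ⟨C, fun t => (dist_comm (r₂.1 t) (r₁.1 t)).le.trans (h t)⟩
      trans := fun {r₁ r₂ r₃} ⟨C, h⟩ ⟨D, k⟩ => ⟨C + D, fun t =>
        (dist_triangle (r₁.1 t) (r₂.1 t) (r₃.1 t)).trans (add_le_add (h t) (k t))⟩ }

/-- The boundary at infinity `∂X`: asymptoty classes of geodesic rays in `X`. -/
def Boundary : Type u := Quotient (asymptotic X)

variable {X}

/-- An isometric action on `X` induces an action on geodesic rays. -/
instance rayMulAction {G : Type v} [Group G] [MulAction G X] [IsIsometricSMul G X] :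
    MulAction G (GeodesicRay X) where
  smul g r := ⟨fun t => g • r.1 t, (isometry_smul X g).comp r.2⟩
  one_smul r := Subtype.ext (funext fun t => one_smul G (r.1 t))
  mul_smul g h r := Subtype.ext (funext fun t => mul_smul g h (r.1 t))

/-- An isometric action on `X` induces an action on `∂X`. -/
instance boundaryMulAction {G : Type v} [Group G] [MulAction G X] [IsIsometricSMul G X] :
    MulAction G (Boundary X) where
  smul g := Quotient.map (fun r => g • r) fun _ _ ⟨C, h⟩ =>
    ⟨C, fun t => ((isometry_smul X g).dist_eq _ _).le.trans (h t)⟩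
  one_smul ξ := Quotient.inductionOn ξ fun r =>
    congrArg (Quotient.mk (asymptotic X)) (one_smul G r)
  mul_smul g h ξ := Quotient.inductionOn ξ fun r =>
    congrArg (Quotient.mk (asymptotic X)) (mul_smul g h r)

end Geodesics

/-- A metric space `Z` with an action of `G = ∏ i, G i` splits `G`-equivariantly and isometrically
as a product of `G i`-spaces: there are metric spaces `Y i` with an isometric action of `G i` and
a bijection `φ` from `Z` onto the product of the `Y i` which is isometric for the product metric
`d(y, y')² = ∑ i, d(y i, y' i)²` and satisfies `φ (g z) = (g i • φ z i)_i`. -/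
def SplitsEquivariantly {n : ℕ} (G : Fin n → Type v) [∀ i, Group (G i)]
    (Z : Type u) [MetricSpace Z] [MulAction (∀ i, G i) Z] : Prop :=
  ∃ (Y : Fin n → Type u) (_ : ∀ i, MetricSpace (Y i)) (_ : ∀ i, MulAction (G i) (Y i))
    (_ : ∀ i, IsIsometricSMul (G i) (Y i)) (φ : Z ≃ ∀ i, Y i),
    (∀ z w : Z, dist z w ^ 2 = ∑ i, dist (φ z i) (φ w i) ^ 2) ∧
      ∀ (g : ∀ i, G i) (z : Z) (i : Fin n), φ (g • z) i = g i • φ z i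

end CATZero

/-! The argument is an induction on the number of factors, splitting off H = `G 0` from the
commuting product K of the others. Suppose that no point of the boundary is fixed. By properness,
any set on which each group element has bounded displacement is then bounded: otherwise segments to
far points of it would subconverge to a ray fixed at infinity (`isBounded_of_bounded_displacement`).
This is the only use of the assumption. It gives a minimal non-empty closed convex H-invariant set C
(`exists_minimal`).

On a minimal set every continuous H-invariant quasi-convex function is constant (`eq_of_minimal`).
So two minimal sets are equidistant, nearest point projections between them are mutually inverse
isometries, and Pythagoras holds exactly. An equivariant isometry of a minimal set into itself moves
all points by the same amount. For the holonomy around three minimal sets, a growth estimate forces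
this amount to be 0 (`proj_proj_proj`). Hence the union U of all minimal sets is closed, convex and
isometric to C × T, where T is a fibre of the projection to C.

The group H preserves each leaf and fixes the T-coordinate, while K permutes the leaves and fixes
the C-coordinate: a motion of C induced by K would be a translation with an unbounded orbit of
bounded displacement (`proj_smul_eq_self`). The induction applies to K acting on T. A point of the
boundary of T fixed by K would be fixed by all of G, because each element of H moves all points of T
equally far. So T contains a split subset Z', and its preimage in U is the required set. -/

namespace CATZero

/-! ### Midpoints, convexity and nearest point projections -/

section Midpoints

universe u

variable {X : Type u} [MetricSpace X]

/-- `m` is a metric midpoint of `x` and `y`. -/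
structure IsMid (m x y : X) : Prop where
  left : dist x m = dist x y / 2
  right : dist y m = dist x y / 2

lemma IsMid.symm {m x y : X} (h : IsMid m x y) : IsMid m y x :=
  ⟨by rw [h.right, dist_comm x y], by rw [h.left, dist_comm x y]⟩

lemma isMid_self (x : X) : IsMid x x x := ⟨by simp, by simp⟩

lemma IsGeodesicSegment.isMid {σ : ℝ → X} {x y : X} (h : IsGeodesicSegment σ x y)
    {s t : ℝ} (hs : s ∈ Set.Icc 0 (dist x y)) (ht : t ∈ Set.Icc 0 (dist x y)) :
    IsMid (σ ((s + t) / 2)) (σ s) (σ t) := by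
  have hm : (s + t) / 2 ∈ Set.Icc 0 (dist x y) :=
    ⟨by linarith [hs.1, ht.1], by linarith [hs.2, ht.2]⟩
  constructor
  · rw [h.isometric _ hs _ hm, h.isometric _ hs _ ht, show s - (s + t) / 2 = (s - t) / 2 by ring,
      abs_div, abs_two]
  · rw [h.isometric _ ht _ hm, h.isometric _ hs _ ht,
      show t - (s + t) / 2 = - ((s - t) / 2) by ring, abs_neg, abs_div, abs_two]

lemma IsGeodesicSegment.isMid_half {σ : ℝ → X} {x y : X} (h : IsGeodesicSegment σ x y) :
    IsMid (σ (dist x y / 2)) x y := by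
  have := h.isMid (s := 0) (t := dist x y) ⟨le_rfl, dist_nonneg⟩ ⟨dist_nonneg, le_rfl⟩
  rwa [h.source, h.target, zero_add] at this

/-- A set is midpoint convex if it contains all midpoints of its points. -/
def MidConvex (A : Set X) : Prop := ∀ x ∈ A, ∀ y ∈ A, ∀ m, IsMid m x y → m ∈ A

/-- A missed parameter `t` would lie in a gap between a last parameter `a` and a first parameter `b`
where the segment is in `A`, and the midpoint of the gap contradicts this choice. It lets the later
arguments handle midpoints only. -/
lemma MidConvex.isConvex {A : Set X} (hA : MidConvex A) (hc : IsClosed A) : IsConvex A := by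
  intro x hx y hy σ hσ t ht
  by_contra hn
  have hcont : ContinuousOn σ (Set.Icc 0 (dist x y)) := by
    have : LipschitzOnWith 1 σ (Set.Icc 0 (dist x y)) :=
      LipschitzOnWith.of_dist_le_mul fun s hs t ht => by
        rw [hσ.isometric s hs t ht, NNReal.coe_one, one_mul, Real.dist_eq]
    exact this.continuousOn
  have hS : IsClosed (Set.Icc 0 (dist x y) ∩ σ ⁻¹' A) :=
    hcont.preimage_isClosed_of_isClosed isClosed_Icc hc
  set S := Set.Icc 0 (dist x y) ∩ σ ⁻¹' A with hSdef
  have h0 : (0 : ℝ) ∈ S ∩ Set.Iic t :=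
    ⟨⟨⟨le_rfl, dist_nonneg⟩, by simpa [hσ.source] using hx⟩, ht.1⟩
  have h1 : dist x y ∈ S ∩ Set.Ici t :=
    ⟨⟨⟨dist_nonneg, le_rfl⟩, by simpa [hσ.target] using hy⟩, ht.2⟩
  have ha := (hS.inter isClosed_Iic).csSup_mem ⟨_, h0⟩ ⟨t, fun _ h => h.2⟩
  have hb := (hS.inter isClosed_Ici).csInf_mem ⟨_, h1⟩ ⟨t, fun _ h => h.2⟩
  set a := sSup (S ∩ Set.Iic t) with hadef
  set b := sInf (S ∩ Set.Ici t) with hbdef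
  have hm : (a + b) / 2 ∈ S :=
    ⟨⟨by linarith [ha.1.1.1, hb.1.1.1], by linarith [ha.1.1.2, hb.1.1.2]⟩,
      hA _ ha.1.2 _ hb.1.2 _ (hσ.isMid ha.1.1 hb.1.1)⟩
  have hat : a ≤ t := ha.2
  have hbt : t ≤ b := hb.2
  rcases le_total ((a + b) / 2) t with h | h
  · have : (a + b) / 2 ≤ a := le_csSup ⟨t, fun _ h => h.2⟩ ⟨hm, h⟩
    have : t = a := by linarith
    exact hn (this ▸ ha.1.2)
  · have : b ≤ (a + b) / 2 := csInf_le ⟨t, fun _ h => h.2⟩ ⟨hm, h⟩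
    have : t = b := by linarith
    exact hn (this ▸ hb.1.2)

namespace IsCATZero

variable (hX : IsCATZero X)
include hX

lemma exists_isMid (x y : X) : ∃ m, IsMid m x y :=
  let ⟨_, hσ⟩ := hX.geodesic x y
  ⟨_, hσ.isMid_half⟩

/-- The axiom concerns midpoints of geodesics; evaluated at a metric midpoint `m` it shows that `m`
coincides with the midpoint of the geodesic. -/
lemma bruhat_tits_isMid {m c c' : X} (hm : IsMid m c c') (x : X) :
    2 * dist x m ^ 2 ≤ dist x c ^ 2 + dist x c' ^ 2 - 1 / 2 * dist c c' ^ 2 := by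
  obtain ⟨σ, hσ⟩ := hX.geodesic c c'
  have key := fun z => hX.bruhat_tits z c c' σ hσ
  have hmσ : σ (dist c c' / 2) = m := by
    have := key m
    rw [hm.left, hm.right, dist_comm c' c] at this
    have h0 : dist (σ (dist c c' / 2)) m ^ 2 ≤ 0 := by nlinarith
    exact dist_eq_zero.1 (pow_eq_zero_iff two_ne_zero |>.1 (le_antisymm h0 (sq_nonneg _)))
  have := key x
  rw [hmσ, dist_comm c' c, dist_comm m, dist_comm c', dist_comm c x] at this
  linarith

lemma isMid_unique {m m' x y : X} (h : IsMid m x y) (h' : IsMid m' x y) : m = m' := by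
  have := hX.bruhat_tits_isMid h m'
  rw [dist_comm m' x, dist_comm m' y, h'.left, h'.right] at this
  have h0 : dist m' m ^ 2 ≤ 0 := by nlinarith
  exact (dist_eq_zero.1 (pow_eq_zero_iff two_ne_zero |>.1 (le_antisymm h0 (sq_nonneg _)))).symm

lemma midConvex_of_isConvex {A : Set X} (hA : IsConvex A) : MidConvex A := by
  intro x hx y hy m hm
  obtain ⟨σ, hσ⟩ := hX.geodesic x y
  rw [hX.isMid_unique hm hσ.isMid_half]
  exact hA x hx y hy σ hσ _ ⟨by positivity, by linarith [dist_nonneg (x := x) (y := y)]⟩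

/-- The quadrilateral inequality: the squares of the diagonals sum up to at most the sum of the
squares of the sides. -/
lemma quadrilateral (a b c d : X) :
    dist a c ^ 2 + dist b d ^ 2 ≤ dist a b ^ 2 + dist b c ^ 2 + dist c d ^ 2 + dist a d ^ 2 := by
  obtain ⟨m, hm⟩ := hX.exists_isMid a c
  have hb := hX.bruhat_tits_isMid hm b
  have hd := hX.bruhat_tits_isMid hm d
  have ht := dist_triangle b m d
  rw [dist_comm m d] at ht
  rw [dist_comm b a] at hb
  rw [dist_comm d a, dist_comm d c] at hd
  have h0 : dist b d ^ 2 ≤ (dist b m + dist d m) ^ 2 := by gcongr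
  nlinarith [sq_nonneg (dist b m - dist d m)]

lemma dist_isMid_isMid_common {m m' a b c : X} (h : IsMid m a b) (h' : IsMid m' a c) :
    dist m m' ≤ dist b c / 2 := by
  have h1 := hX.bruhat_tits_isMid h c
  have h2 := hX.bruhat_tits_isMid h' m
  rw [dist_comm m a, h.left, dist_comm m c] at h2
  rw [dist_comm c a, dist_comm c b] at h1
  refine abs_le_of_sq_le_sq' ?_ (by positivity) |>.2
  nlinarith

lemma dist_isMid_isMid {m m' a b c d : X} (h : IsMid m a b) (h' : IsMid m' c d) :
    dist m m' ≤ (dist a c + dist b d) / 2 := by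
  obtain ⟨n, hn⟩ := hX.exists_isMid a d
  have h1 := hX.dist_isMid_isMid_common h hn
  have h2 := hX.dist_isMid_isMid_common hn.symm h'.symm
  linarith [dist_triangle m n m']

end IsCATZero

/-- `p` is a point of `A` nearest to `x`. -/
def IsProj (A : Set X) (x p : X) : Prop := p ∈ A ∧ ∀ c ∈ A, dist x p ≤ dist x c

/-- Non-empty closed (midpoint) convex sets. -/
structure IsCC (A : Set X) : Prop where
  nonempty : A.Nonempty
  closed : IsClosed A
  convex : MidConvex A

open Classical in
/-- The nearest point projection. -/
noncomputable def proj (A : Set X) (x : X) : X :=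
  if h : ∃ p, IsProj A x p then h.choose else x

lemma IsCC.isProj_proj [ProperSpace X] {A : Set X} (hA : IsCC A) (x : X) :
    IsProj A x (proj A x) := by
  have h : ∃ p, IsProj A x p := by
    obtain ⟨p, hp, h⟩ := hA.closed.exists_infDist_eq_dist hA.nonempty x
    exact ⟨p, hp, fun c hc => h ▸ Metric.infDist_le_dist_of_mem hc⟩
  rw [proj, dif_pos h]
  exact h.choose_spec

lemma IsCC.proj_mem [ProperSpace X] {A : Set X} (hA : IsCC A) (x : X) : proj A x ∈ A :=
  (hA.isProj_proj x).1

lemma IsCC.dist_proj [ProperSpace X] {A : Set X} (hA : IsCC A) (x : X) :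
    dist x (proj A x) = Metric.infDist x A :=
  le_antisymm ((Metric.le_infDist hA.nonempty).2 fun {y} h => (hA.isProj_proj x).2 y h)
    (Metric.infDist_le_dist_of_mem (hA.proj_mem x))

namespace IsCATZero

variable (hX : IsCATZero X)
include hX

/-- Halving the segment from `p` to `c` and applying Bruhat-Tits improves a coefficient `1 - 2⁻ᵏ` of
`dist p c ^ 2` to `1 - 2⁻ᵏ⁻¹`; minimality of `p` is the case `k = 0`. -/
lemma pythagoras_le {A : Set X} (hA : MidConvex A) {x p : X} (hp : IsProj A x p) {c : X}
    (hc : c ∈ A) : dist x p ^ 2 + dist p c ^ 2 ≤ dist x c ^ 2 := by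
  have key : ∀ k : ℕ, ∀ c ∈ A,
      dist x p ^ 2 + (1 - (1 / 2 : ℝ) ^ k) * dist p c ^ 2 ≤ dist x c ^ 2 := by
    intro k
    induction k with
    | zero =>
      intro c hc
      have := hp.2 c hc
      have : dist x p ^ 2 ≤ dist x c ^ 2 := by gcongr
      simpa using this
    | succ k ih =>
      intro c hc
      obtain ⟨m, hm⟩ := hX.exists_isMid p c
      have h1 := ih m (hA p hp.1 c hc m hm)
      have h2 := hX.bruhat_tits_isMid hm x
      rw [hm.left] at h1
      rw [pow_succ (1 / 2 : ℝ)]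
      nlinarith
  have hlim : Filter.Tendsto
      (fun k : ℕ => dist x p ^ 2 + (1 - (1 / 2 : ℝ) ^ k) * dist p c ^ 2) Filter.atTop
      (nhds (dist x p ^ 2 + (1 - 0) * dist p c ^ 2)) :=
    ((tendsto_const_nhds.sub (tendsto_pow_atTop_nhds_zero_of_lt_one (by norm_num)
      (by norm_num))).mul_const _).const_add _
  have := le_of_tendsto' hlim fun k => key k c hc
  simpa using this

lemma isProj_unique {A : Set X} (hA : MidConvex A) {x p q : X} (hp : IsProj A x p)
    (hq : IsProj A x q) : p = q := by
  have h1 := hX.pythagoras_le hA hp hq.1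
  have h2 := hX.pythagoras_le hA hq hp.1
  rw [dist_comm q p] at h2
  have h0 : dist p q ^ 2 ≤ 0 := by linarith
  exact dist_eq_zero.1 (pow_eq_zero_iff two_ne_zero |>.1 (le_antisymm h0 (sq_nonneg _)))

variable [ProperSpace X]

lemma eq_proj {A : Set X} (hA : IsCC A) {x p : X} (hp : IsProj A x p) : p = proj A x :=
  hX.isProj_unique hA.convex hp (hA.isProj_proj x)

lemma dist_proj_le {A : Set X} (hA : IsCC A) (x y : X) :
    dist (proj A x) (proj A y) ≤ dist x y := by
  have h1 := hX.pythagoras_le hA.convex (hA.isProj_proj x) (hA.proj_mem y)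
  have h2 := hX.pythagoras_le hA.convex (hA.isProj_proj y) (hA.proj_mem x)
  have h3 := hX.quadrilateral x (proj A x) (proj A y) y
  rw [dist_comm (proj A y) (proj A x), dist_comm y (proj A x)] at h2
  rw [dist_comm (proj A y) y] at h3
  refine abs_le_of_sq_le_sq' ?_ dist_nonneg |>.2
  linarith

lemma continuous_proj {A : Set X} (hA : IsCC A) : Continuous (proj A) :=
  (LipschitzWith.of_dist_le_mul (K := 1) fun x y => by
    simpa using hX.dist_proj_le hA x y).continuous

lemma infDist_isMid_le {A : Set X} (hA : IsCC A) {m x y : X} (hm : IsMid m x y) :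
    Metric.infDist m A ≤ max (Metric.infDist x A) (Metric.infDist y A) := by
  obtain ⟨n, hn⟩ := hX.exists_isMid (proj A x) (proj A y)
  have h1 := hX.dist_isMid_isMid hm hn
  have h2 := Metric.infDist_le_dist_of_mem (x := m)
    (hA.convex _ (hA.proj_mem x) _ (hA.proj_mem y) _ hn)
  rw [hA.dist_proj, hA.dist_proj] at h1
  linarith [le_max_left (Metric.infDist x A) (Metric.infDist y A),
    le_max_right (Metric.infDist x A) (Metric.infDist y A)]

lemma proj_smul {G : Type*} [Group G] [MulAction G X] [IsIsometricSMul G X] {A B : Set X}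
    (hA : IsCC A) (hB : IsCC B) {g : G} (h : ∀ x, g • x ∈ B ↔ x ∈ A) (x : X) :
    proj B (g • x) = g • proj A x := by
  refine (hX.eq_proj hB ⟨(h _).2 (hA.proj_mem x), fun c hc => ?_⟩).symm
  have hc' : g⁻¹ • c ∈ A := (h _).1 (by simpa using hc)
  have := (hA.isProj_proj x).2 _ hc'
  rwa [dist_smul, ← dist_smul g x (g⁻¹ • c), smul_inv_smul] at *

end IsCATZero

lemma IsMid.map {m x y : X} (h : IsMid m x y) {f : X → X} {A : Set X}
    (hf : ∀ a ∈ A, ∀ b ∈ A, dist (f a) (f b) = dist a b) (hx : x ∈ A) (hy : y ∈ A) (hm : m ∈ A) :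
    IsMid (f m) (f x) (f y) :=
  ⟨by rw [hf _ hx _ hm, hf _ hx _ hy, h.left], by rw [hf _ hy _ hm, hf _ hx _ hy, h.right]⟩

lemma IsMid.smul {G : Type*} [Group G] [MulAction G X] [IsIsometricSMul G X]
    {m x y : X} (h : IsMid m x y) (g : G) : IsMid (g • m) (g • x) (g • y) :=
  ⟨by rw [dist_smul, dist_smul, h.left], by rw [dist_smul, dist_smul, h.right]⟩

/-- The sublevel sets of displacement functions are midpoint convex. -/
lemma IsCATZero.midConvex_displacement (hX : IsCATZero X) {G : Type*} [Group G] [MulAction G X]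
    [IsIsometricSMul G X] (g : G) (B : ℝ) : MidConvex {x : X | dist (g • x) x ≤ B} := by
  intro x hx y hy m hm
  have := hX.dist_isMid_isMid (hm.smul g) hm
  simp only [Set.mem_ofPred_eq] at *
  linarith

lemma isClosed_displacement {G : Type*} [Group G] [MulAction G X]
    [IsIsometricSMul G X] (g : G) (B : ℝ) : IsClosed {x : X | dist (g • x) x ≤ B} :=
  isClosed_le ((isometry_smul X g).continuous.dist continuous_id) continuous_const

end Midpoints

/-! ### Fixed points at infinity from bounded displacement -/

section BoundaryFixedPoints

universe u

variable {X : Type u} [MetricSpace X] [ProperSpace X]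

/-- If a group acts on a proper CAT(0) space without fixing a point at infinity, then every set
on which each group element has bounded displacement is bounded. -/
lemma IsCATZero.isBounded_of_bounded_displacement (hX : IsCATZero X) {G : Type*} [Group G]
    [MulAction G X] [IsIsometricSMul G X] (hG : ¬ ∃ ξ : Boundary X, ∀ g : G, g • ξ = ξ)
    {S : Set X} (hS : ∀ g : G, ∃ B : ℝ, ∀ x ∈ S, dist (g • x) x ≤ B) : Bornology.IsBounded S := by
  rcases S.eq_empty_or_nonempty with rfl | ⟨x₀, -⟩
  · exact Bornology.isBounded_empty
  by_contra hb
  apply hG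
  have hfar : ∀ k : ℕ, ∃ x ∈ S, (k : ℝ) < dist x₀ x := by
    intro k
    by_contra! h
    exact hb (Metric.isBounded_closedBall.subset (s := S) (t := Metric.closedBall x₀ k)
      fun x hx => by rw [Metric.mem_closedBall, dist_comm]; exact h x hx)
  choose x hxS hx using hfar
  choose σ hσ using fun k => hX.geodesic x₀ (x k)
  have hmem : ∀ (t : ℝ≥0) (k : ℕ), (t : ℝ) ≤ k → (t : ℝ) ∈ Set.Icc 0 (dist x₀ (x k)) :=
    fun t k h => ⟨t.2, h.trans (hx k).le⟩
  have hev : ∀ t : ℝ≥0, ∀ᶠ k : ℕ in (Filter.hyperfilter ℕ : Filter ℕ), (t : ℝ) ≤ k := by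
    intro t
    have : ∀ᶠ k : ℕ in Filter.atTop, (t : ℝ) ≤ k :=
      tendsto_natCast_atTop_atTop.eventually_ge_atTop _
    exact Nat.hyperfilter_le_atTop this
  -- A non-principal ultrafilter gives limits for all `t` at once, instead of a diagonal
  -- subsequence; `σ k t` is meaningful only once `k ≥ t`.
  have hlim : ∀ t : ℝ≥0, ∃ y, Filter.Tendsto (fun k => σ k t)
      (Filter.hyperfilter ℕ : Filter ℕ) (nhds y) := by
    intro t
    have hball : ∀ᶠ k : ℕ in (Filter.hyperfilter ℕ : Filter ℕ),
        σ k t ∈ Metric.closedBall x₀ (t : ℝ) := by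
      filter_upwards [hev t] with k hk
      rw [Metric.mem_closedBall, ← (hσ k).source,
        (hσ k).isometric _ (hmem t k hk) _ ⟨le_rfl, dist_nonneg⟩, sub_zero,
        abs_of_nonneg t.coe_nonneg]
    obtain ⟨y, -, hy⟩ := (isCompact_closedBall x₀ (t : ℝ)).ultrafilter_le_nhds
      ((Filter.hyperfilter ℕ).map fun k => σ k t) (Filter.le_principal_iff.2 hball)
    exact ⟨y, hy⟩
  choose r hr using hlim
  have hiso : Isometry r := by
    refine Isometry.of_dist_eq fun s t => tendsto_nhds_unique ((hr s).dist (hr t)) ?_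
    refine tendsto_const_nhds.congr' ?_
    filter_upwards [hev s, hev t] with k hs ht
    rw [(hσ k).isometric _ (hmem s k hs) _ (hmem t k ht), NNReal.dist_eq]
  refine ⟨Quotient.mk (asymptotic X) ⟨r, hiso⟩, fun g => Quotient.sound ?_⟩
  obtain ⟨B, hB⟩ := hS g
  refine ⟨max B (dist (g • x₀) x₀), fun t => ?_⟩
  change dist (g • r t) (r t) ≤ _
  refine le_of_tendsto (((hr t).const_smul g).dist (hr t)) ?_
  filter_upwards [hev t] with k hk
  -- The displacement of `g` is bounded at both ends of the segment, hence along it, by convexity of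
  -- sublevel sets.
  exact Set.mem_ofPred.1 <| (hX.midConvex_displacement g _).isConvex (isClosed_displacement g _) x₀
    (Set.mem_ofPred.2 (le_max_right _ _)) (x k)
    (Set.mem_ofPred.2 ((hB _ (hxS k)).trans (le_max_left _ _))) (σ k) (hσ k) t (hmem t k hk)

end BoundaryFixedPoints

/-! ### Minimal invariant convex sets and their parallelism -/

section MinimalSets

universe u

variable {X : Type u} [MetricSpace X] {G : Type*} [Group G] [MulAction G X]

/-- Non-empty closed convex `H`-invariant sets. -/
structure IsInvCC (H : Subgroup G) (C : Set X) : Prop extends IsCC C where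
  smul_mem : ∀ h ∈ H, ∀ x ∈ C, h • x ∈ C

lemma IsInvCC.smul_mem_iff {H : Subgroup G} {C : Set X} (hC : IsInvCC H C) {h : G} (hh : h ∈ H)
    (x : X) : h • x ∈ C ↔ x ∈ C :=
  ⟨fun hx => by simpa using hC.smul_mem _ (H.inv_mem hh) _ hx, hC.smul_mem h hh x⟩

/-- On a minimal invariant set, invariant continuous quasi-convex functions are constant. -/
lemma eq_of_minimal {H : Subgroup G} {C : Set X} (hC : Minimal (IsInvCC H) C) {f : X → ℝ}
    (hf : Continuous f)
    (hconv : ∀ x ∈ C, ∀ y ∈ C, ∀ m ∈ C, IsMid m x y → f m ≤ max (f x) (f y))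
    (hinv : ∀ h ∈ H, ∀ x ∈ C, f (h • x) = f x) {x y : X} (hx : x ∈ C) (hy : y ∈ C) :
    f x = f y := by
  have key : ∀ x ∈ C, ∀ y ∈ C, f y ≤ f x := by
    intro x hx y hy
    have hD : IsInvCC H (C ∩ {z | f z ≤ f x}) :=
      { nonempty := ⟨x, hx, Set.mem_ofPred.2 le_rfl⟩
        closed := hC.1.closed.inter (isClosed_le hf continuous_const)
        convex := fun a ha b hb m hm =>
          have hmC := hC.1.convex a ha.1 b hb.1 m hm
          ⟨hmC, Set.mem_ofPred.2 ((hconv a ha.1 b hb.1 m hmC hm).trans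
            (max_le (Set.mem_ofPred.1 ha.2) (Set.mem_ofPred.1 hb.2)))⟩
        smul_mem := fun h hh a ha => ⟨hC.1.smul_mem h hh a ha.1,
          Set.mem_ofPred.2 ((hinv h hh a ha.1).le.trans (Set.mem_ofPred.1 ha.2))⟩ }
    exact Set.mem_ofPred.1 (hC.2 hD Set.inter_subset_left hy).2
  exact le_antisymm (key y hy x hx) (key x hx y hy)

lemma minimal_eq_of_mem {H : Subgroup G} {C C' : Set X} (hC : Minimal (IsInvCC H) C)
    (hC' : Minimal (IsInvCC H) C') {x : X} (hx : x ∈ C) (hx' : x ∈ C') : C = C' := by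
  have hD : IsInvCC H (C ∩ C') :=
    { nonempty := ⟨x, hx, hx'⟩
      closed := hC.1.closed.inter hC'.1.closed
      convex := fun a ha b hb m hm =>
        ⟨hC.1.convex a ha.1 b hb.1 m hm, hC'.1.convex a ha.2 b hb.2 m hm⟩
      smul_mem := fun h hh a ha => ⟨hC.1.smul_mem h hh a ha.1, hC'.1.smul_mem h hh a ha.2⟩ }
  exact Set.Subset.antisymm (fun y hy => (hC.2 hD Set.inter_subset_left hy).2)
    (fun y hy => (hC'.2 hD Set.inter_subset_right hy).1)

variable [ProperSpace X]

/-- The image of a minimal set under an equivariant isometric embedding is minimal. -/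
lemma IsCATZero.minimal_image (hX : IsCATZero X) {H : Subgroup G} {C : Set X}
    (hC : Minimal (IsInvCC H) C) {f : X → X}
    (hf : ∀ a ∈ C, ∀ b ∈ C, dist (f a) (f b) = dist a b)
    (hequiv : ∀ h ∈ H, ∀ x ∈ C, f (h • x) = h • f x) : Minimal (IsInvCC H) (f '' C) := by
  have hiso : Isometry fun x : C => f x := Isometry.of_dist_eq fun a b => hf a a.2 b b.2
  have : CompleteSpace C := hC.1.closed.completeSpace_coe
  have hcont : ContinuousOn f C := continuousOn_iff_continuous_domRestrict.2 hiso.continuous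
  refine ⟨⟨⟨hC.1.nonempty.image f, ?_, ?_⟩, ?_⟩, ?_⟩
  · have := hiso.isClosedEmbedding.isClosed_range
    rwa [show (Set.range fun x : C => f x) = f '' C from (Set.image_eq_range f C).symm] at this
  · rintro _ ⟨a, ha, rfl⟩ _ ⟨b, hb, rfl⟩ m hm
    obtain ⟨n, hn⟩ := hX.exists_isMid a b
    have hnC := hC.1.convex a ha b hb n hn
    exact ⟨n, hnC, hX.isMid_unique (hn.map hf ha hb hnC) hm⟩
  · rintro h hh _ ⟨a, ha, rfl⟩
    exact ⟨h • a, hC.1.smul_mem h hh a ha, hequiv h hh a ha⟩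
  · intro D hD hDC
    have hE : IsInvCC H (C ∩ f ⁻¹' D) :=
      { nonempty := by
          obtain ⟨y, hy⟩ := hD.nonempty
          obtain ⟨x, hx, rfl⟩ := hDC hy
          exact ⟨x, hx, hy⟩
        closed := hcont.preimage_isClosed_of_isClosed hC.1.closed hD.closed
        convex := fun a ha b hb m hm =>
          have hmC := hC.1.convex a ha.1 b hb.1 m hm
          ⟨hmC, hD.convex _ ha.2 _ hb.2 _ (hm.map hf ha.1 hb.1 hmC)⟩
        smul_mem := fun h hh a ha => ⟨hC.1.smul_mem h hh a ha.1, by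
          rw [Set.mem_preimage, hequiv h hh a ha.1]
          exact hD.smul_mem h hh _ ha.2⟩ }
    rintro _ ⟨x, hx, rfl⟩
    exact (hC.2 hE Set.inter_subset_left hx).2

variable [IsIsometricSMul G X]

/-- Existence of minimal invariant sets for a subgroup `H` with complementary commuting
subgroup `K`, provided unbounded sets have unbounded displacement. -/
lemma IsCATZero.exists_minimal [Nonempty X] (hX : IsCATZero X) {H K : Subgroup G}
    (hcomm : ∀ h ∈ H, ∀ k ∈ K, h * k = k * h)
    (hbd : ∀ S : Set X, (∀ h ∈ H, ∃ B : ℝ, ∀ x ∈ S, dist (h • x) x ≤ B) →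
      (∀ k ∈ K, ∃ B : ℝ, ∀ x ∈ S, dist (k • x) x ≤ B) → Bornology.IsBounded S) :
    ∃ C : Set X, Minimal (IsInvCC H) C := by
  obtain ⟨x₀⟩ := ‹Nonempty X›
  -- Zorn is run inside `C₀`, where K-displacements are under control; `C₀` is H-invariant because H
  -- and K commute.
  let C₀ : Set X := {x | ∀ k ∈ K, dist (k • x) x ≤ dist (k • x₀) x₀}
  have hC₀ : IsInvCC H C₀ :=
    { nonempty := ⟨x₀, Set.mem_ofPred.2 fun _ _ => le_rfl⟩
      closed := by
        have : C₀ = ⋂ k ∈ K, {x | dist (k • x) x ≤ dist (k • x₀) x₀} := by ext; simp [C₀]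
        rw [this]
        exact isClosed_biInter fun k _ => isClosed_displacement k _
      convex := fun a ha b hb m hm => Set.mem_ofPred.2 fun k hk =>
        hX.midConvex_displacement k _ a (Set.mem_ofPred.1 ha k hk) b (Set.mem_ofPred.1 hb k hk) m hm
      smul_mem := fun h hh a ha => Set.mem_ofPred.2 fun k hk => by
        rw [smul_smul, ← hcomm h hh k hk, mul_smul, dist_smul]
        exact Set.mem_ofPred.1 ha k hk }
  obtain ⟨C, hCC₀, hC⟩ := zorn_superset_nonempty {C | IsInvCC H C ∧ C ⊆ C₀}
    (fun c hc hchain hne => by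
      have hcc : ∀ C ∈ c, IsInvCC H C ∧ C ⊆ C₀ := fun C hC => Set.mem_ofPred.1 (hc hC)
      -- H-displacements are bounded since projections are equivariant and 1-Lipschitz. Once these
      -- points lie in one ball, compactness makes the intersection of the chain non-empty.
      have hbdd : Bornology.IsBounded ((fun C => proj C x₀) '' c) := by
        apply hbd
        · intro h hh
          refine ⟨dist (h • x₀) x₀, ?_⟩
          rintro _ ⟨C, hC, rfl⟩
          have hCi := (hcc C hC).1
          change dist (h • proj C x₀) (proj C x₀) ≤ _
          rw [← hX.proj_smul hCi.toIsCC hCi.toIsCC (hCi.smul_mem_iff hh)]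
          exact hX.dist_proj_le hCi.toIsCC _ _
        · intro k hk
          refine ⟨dist (k • x₀) x₀, ?_⟩
          rintro _ ⟨C, hC, rfl⟩
          exact Set.mem_ofPred.1 ((hcc C hC).2 ((hcc C hC).1.proj_mem x₀)) k hk
      obtain ⟨R, hR⟩ := hbdd.subset_closedBall x₀
      have hne' : (⋂₀ ((fun C => C ∩ Metric.closedBall x₀ R) '' c)).Nonempty := by
        have : Nonempty ((fun C => C ∩ Metric.closedBall x₀ R) '' c) :=
          (hne.image _).to_subtype
        refine IsCompact.nonempty_sInter_of_directed_nonempty_isCompact_isClosed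
          ?_ ?_ ?_ ?_
        · rintro _ ⟨A, hA, rfl⟩ _ ⟨B, hB, rfl⟩
          rcases hchain.total hA hB with h | h
          · exact ⟨_, ⟨A, hA, rfl⟩, subset_rfl, Set.inter_subset_inter_left _ h⟩
          · exact ⟨_, ⟨B, hB, rfl⟩, Set.inter_subset_inter_left _ h, subset_rfl⟩
        · rintro _ ⟨A, hA, rfl⟩
          exact ⟨proj A x₀, (hcc A hA).1.proj_mem x₀, hR ⟨A, hA, rfl⟩⟩
        · rintro _ ⟨A, hA, rfl⟩
          exact (isCompact_closedBall x₀ R).inter_left (hcc A hA).1.closed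
        · rintro _ ⟨A, hA, rfl⟩
          exact (hcc A hA).1.closed.inter Metric.isClosed_closedBall
      obtain ⟨z, hz⟩ := hne'
      refine ⟨⋂₀ c, Set.mem_ofPred.2 ⟨?_, ?_⟩, fun s hs => Set.sInter_subset_of_mem hs⟩
      · exact
          { nonempty := ⟨z, fun A hA => (hz _ ⟨A, hA, rfl⟩).1⟩
            closed := isClosed_sInter fun A hA => (hcc A hA).1.closed
            convex := fun a ha b hb m hm A hA =>
              (hcc A hA).1.convex a (ha A hA) b (hb A hA) m hm
            smul_mem := fun h hh a ha A hA => (hcc A hA).1.smul_mem h hh a (ha A hA) }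
      · obtain ⟨A, hA⟩ := hne
        exact (Set.sInter_subset_of_mem hA).trans (hcc A hA).2)
    C₀ (Set.mem_ofPred.2 ⟨hC₀, subset_rfl⟩)
  have hC1 := Set.mem_ofPred.1 hC.1
  exact ⟨C, hC1.1, fun D hD hDC =>
    hC.2 (Set.mem_ofPred.2 ⟨hD, (show D ⊆ C from hDC).trans hC1.2⟩) hDC⟩

namespace IsCATZero

variable (hX : IsCATZero X) {H : Subgroup G}
include hX

lemma proj_smul_of_mem {C : Set X} (hC : IsInvCC H C) {h : G} (hh : h ∈ H) (x : X) :
    proj C (h • x) = h • proj C x :=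
  hX.proj_smul hC.toIsCC hC.toIsCC (hC.smul_mem_iff hh) x

lemma infDist_eq {C C' : Set X} (hC : Minimal (IsInvCC H) C) (hC' : IsInvCC H C')
    {x y : X} (hx : x ∈ C) (hy : y ∈ C) : Metric.infDist x C' = Metric.infDist y C' :=
  eq_of_minimal hC (Metric.continuous_infDist_pt C')
    (fun _ _ _ _ _ _ hm => hX.infDist_isMid_le hC'.toIsCC hm)
    (fun h hh x _ => by
      rw [← hC'.dist_proj, ← hC'.dist_proj, hX.proj_smul_of_mem hC' hh, dist_smul]) hx hy

variable {C C' : Set X} (hC : Minimal (IsInvCC H) C) (hC' : Minimal (IsInvCC H) C')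
include hC hC'

lemma infDist_comm {x y : X} (hx : x ∈ C) (hy : y ∈ C') :
    Metric.infDist x C' = Metric.infDist y C := by
  have key : ∀ {C C' : Set X} (_ : Minimal (IsInvCC H) C) (_ : Minimal (IsInvCC H) C')
      {x y : X} (_ : x ∈ C) (_ : y ∈ C'), Metric.infDist y C ≤ Metric.infDist x C' := by
    intro C C' hC hC' x y hx hy
    rw [hX.infDist_eq hC' hC.1 hy (hC'.1.proj_mem x), ← hC'.1.dist_proj x, dist_comm]
    exact Metric.infDist_le_dist_of_mem hx
  exact le_antisymm (key hC' hC hy hx) (key hC hC' hx hy)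

lemma proj_proj {x : X} (hx : x ∈ C) : proj C (proj C' x) = x := by
  refine (hX.eq_proj hC.1.toIsCC ⟨hx, fun c hc => ?_⟩).symm
  rw [dist_comm, hC'.1.dist_proj, hX.infDist_comm hC hC' hx (hC'.1.proj_mem x)]
  exact Metric.infDist_le_dist_of_mem hc

lemma dist_proj_proj {x y : X} (hx : x ∈ C) (hy : y ∈ C) :
    dist (proj C' x) (proj C' y) = dist x y := by
  refine le_antisymm (hX.dist_proj_le hC'.1.toIsCC x y) ?_
  have := hX.dist_proj_le hC.1.toIsCC (proj C' x) (proj C' y)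
  rwa [hX.proj_proj hC hC' hx, hX.proj_proj hC hC' hy] at this

/-- The points `x`, `proj C' x`, `y`, `proj C y` form a quadrilateral with equal opposite sides.
Both diagonals are bounded below by `pythagoras_le`, and the quadrilateral inequality turns this
into equality. -/
lemma pythagoras {x y : X} (hx : x ∈ C) (hy : y ∈ C') :
    dist x y ^ 2 = dist (proj C' x) y ^ 2 + Metric.infDist x C' ^ 2 := by
  have h1 := hX.pythagoras_le hC'.1.convex (hC'.1.isProj_proj x) hy
  have h2 := hX.pythagoras_le hC.1.convex (hC.1.isProj_proj (proj C' x)) (hC.1.proj_mem y)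
  have h3 := hX.quadrilateral x (proj C' x) y (proj C y)
  have h4 := hX.dist_proj_proj hC hC' hx (hC.1.proj_mem y)
  rw [hX.proj_proj hC' hC hy] at h4
  rw [hX.proj_proj hC hC' hx, dist_comm _ x] at h2
  rw [hC'.1.dist_proj] at h1 h3 h2
  have h5 := hC.1.dist_proj y
  rw [← hX.infDist_comm hC hC' hx hy] at h5
  rw [h5, ← h4] at h3
  rw [← h4] at h2
  linarith

end IsCATZero

end MinimalSets

/-! ### Clifford translations -/

section CliffordTranslations

universe u

variable {X : Type u} [MetricSpace X]

lemma dist_iterate_le {C : Set X} {f : X → X} {δ : ℝ} (hmaps : Set.MapsTo f C C)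
    (hδ : ∀ x ∈ C, dist x (f x) = δ) (k : ℕ) {x : X} (hx : x ∈ C) :
    dist x (f^[k] x) ≤ k * δ := by
  induction k with
  | zero => simp
  | succ k ih =>
    rw [Function.iterate_succ_apply']
    have := dist_triangle x (f^[k] x) (f (f^[k] x))
    rw [hδ _ (hmaps.iterate k hx)] at this
    push_cast
    linarith

lemma dist_iterate_iterate {C : Set X} {f : X → X} (hmaps : Set.MapsTo f C C)
    (hf : ∀ a ∈ C, ∀ b ∈ C, dist (f a) (f b) = dist a b) (k : ℕ) {a b : X} (ha : a ∈ C)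
    (hb : b ∈ C) : dist (f^[k] a) (f^[k] b) = dist a b := by
  induction k with
  | zero => rfl
  | succ k ih =>
    rw [Function.iterate_succ_apply', Function.iterate_succ_apply',
      hf _ (hmaps.iterate k ha) _ (hmaps.iterate k hb), ih]

/-- A Clifford translation of a convex set translates its orbits along geodesics. -/
lemma IsCATZero.dist_iterate_two_pow (hX : IsCATZero X) {C : Set X} (hC : MidConvex C) {f : X → X}
    (hmaps : Set.MapsTo f C C) (hf : ∀ a ∈ C, ∀ b ∈ C, dist (f a) (f b) = dist a b) {δ : ℝ}
    (hδ : ∀ x ∈ C, dist x (f x) = δ) (j : ℕ) : ∀ x ∈ C, dist x (f^[2 ^ j] x) = 2 ^ j * δ := by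
  induction j with
  | zero => simpa using hδ
  | succ j ih =>
    intro x hx
    have hmaps' := hmaps.iterate (2 ^ j)
    obtain ⟨m, hm⟩ := hX.exists_isMid x (f^[2 ^ j] x)
    have hmC := hC _ hx _ (hmaps' hx) _ hm
    have hm' : IsMid (f^[2 ^ j] m) (f^[2 ^ j] x) (f^[2 ^ j] (f^[2 ^ j] x)) :=
      hm.map (fun a ha b hb => dist_iterate_iterate hmaps hf _ ha hb) hx (hmaps' hx) hmC
    -- With `F = f^[2 ^ j]`, the points `m` and `F m` are midpoints of consecutive segments `x, F x`
    -- and `F x, F (F x)`, so their distance `2 ^ j * δ` is at most half of `dist x (F (F x))`.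
    have h1 := hX.dist_isMid_isMid_common hm.symm hm'
    rw [ih m hmC] at h1
    have h2 := dist_triangle x (f^[2 ^ j] x) (f^[2 ^ j] (f^[2 ^ j] x))
    rw [ih x hx, ih _ (hmaps' hx)] at h2
    rw [← Function.iterate_add_apply, ← two_mul, ← pow_succ'] at h1 h2
    rw [show (2 : ℝ) ^ (j + 1) * δ = 2 * (2 ^ j * δ) by ring]
    linarith

end CliffordTranslations

/-! ### The union of the minimal sets -/

section Parallel

universe u

variable {X : Type u} [MetricSpace X] {G : Type*} [Group G] [MulAction G X]

variable (X) in
/-- The union of all minimal `H`-invariant sets. -/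
def minUnion (H : Subgroup G) : Set X := {x | ∃ C : Set X, Minimal (IsInvCC H) C ∧ x ∈ C}

variable [IsIsometricSMul G X]

namespace IsCATZero

variable (hX : IsCATZero X) {H : Subgroup G}
include hX

/-- An equivariant isometric self-map of a minimal set is a Clifford translation. -/
lemma dist_map_eq_of_minimal {C : Set X} (hC : Minimal (IsInvCC H) C) {f : X → X}
    (hcont : Continuous f) (hf : ∀ a ∈ C, ∀ b ∈ C, dist (f a) (f b) = dist a b)
    (hequiv : ∀ h ∈ H, ∀ x ∈ C, f (h • x) = h • f x) {x y : X} (hx : x ∈ C) (hy : y ∈ C) :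
    dist x (f x) = dist y (f y) :=
  eq_of_minimal hC (f := fun x => dist x (f x)) (continuous_id.dist hcont)
    (fun x hx y hy m hmC hm => by
      have := hX.dist_isMid_isMid hm (hm.map hf hx hy hmC)
      linarith [le_max_left (dist x (f x)) (dist y (f y)),
        le_max_right (dist x (f x)) (dist y (f y))])
    (fun h hh x hx => by simp only [hequiv h hh x hx, dist_smul]) hx hy

variable [ProperSpace X]

/-- The holonomy of three parallel minimal sets is trivial. -/
lemma proj_proj_proj {C₀ C₁ C₂ : Set X} (h₀ : Minimal (IsInvCC H) C₀)
    (h₁ : Minimal (IsInvCC H) C₁) (h₂ : Minimal (IsInvCC H) C₂) {x : X} (hx : x ∈ C₀) :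
    proj C₀ (proj C₂ (proj C₁ x)) = x := by
  set f : X → X := fun x => proj C₀ (proj C₂ (proj C₁ x)) with hfdef
  have hmaps : Set.MapsTo f C₀ C₀ := fun x _ => h₀.1.proj_mem _
  have hf : ∀ a ∈ C₀, ∀ b ∈ C₀, dist (f a) (f b) = dist a b := fun a ha b hb => by
    rw [hfdef, hX.dist_proj_proj h₂ h₀ (h₂.1.proj_mem _) (h₂.1.proj_mem _),
      hX.dist_proj_proj h₁ h₂ (h₁.1.proj_mem _) (h₁.1.proj_mem _), hX.dist_proj_proj h₀ h₁ ha hb]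
  have hcont : Continuous f := (hX.continuous_proj h₀.1.toIsCC).comp
    ((hX.continuous_proj h₂.1.toIsCC).comp (hX.continuous_proj h₁.1.toIsCC))
  have hequiv : ∀ h ∈ H, ∀ x ∈ C₀, f (h • x) = h • f x := fun h hh x _ => by
    simp only [hfdef, hX.proj_smul_of_mem h₁.1 hh, hX.proj_smul_of_mem h₂.1 hh,
      hX.proj_smul_of_mem h₀.1 hh]
  set δ := dist x (f x) with hδdef
  have hδ : ∀ y ∈ C₀, dist y (f y) = δ := fun y hy =>
    hX.dist_map_eq_of_minimal h₀ hcont hf hequiv hy hx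
  have hδ0 : 0 ≤ δ := dist_nonneg
  set b := Metric.infDist (proj C₁ x) C₂
  set c := Metric.infDist (proj C₂ (proj C₁ x)) C₀
  -- Put N = `2 ^ j`. Bruhat-Tits is applied at a point of `C₂` lying over `f^[N] x`, for the
  -- segment from `f^[2N] x` to `proj C₁ x`. Going once around the triangle shifts by one `f`, so
  -- one squared side is at most `((N - 1) * δ) ^ 2 + c ^ 2`, against `(N * δ) ^ 2 + b ^ 2` for the
  -- other and at least `(2 * N * δ) ^ 2` for the base. The quadratic terms cancel and a linear one
  -- is left.
  have key : ∀ j : ℕ, (2 * 2 ^ j - 1) * δ ^ 2 ≤ c ^ 2 + b ^ 2 := by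
    intro j
    have hit : ∀ k, f^[k] x ∈ C₀ := fun k => hmaps.iterate k hx
    obtain ⟨m, hm⟩ := hX.exists_isMid (f^[2 ^ (j + 1)] x) (proj C₁ x)
    set z := proj C₂ (proj C₁ (f^[2 ^ j] x)) with hz
    have hzC : z ∈ C₂ := h₂.1.proj_mem _
    have hbt := hX.bruhat_tits_isMid hm z
    have e1 := hX.pythagoras h₂ h₀ hzC (hit (2 ^ (j + 1)))
    rw [hX.infDist_eq h₂ h₀.1 hzC (h₂.1.proj_mem (proj C₁ x)),
      show proj C₀ z = f^[2 ^ j] (f x) by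
        rw [← Function.iterate_succ_apply, Function.iterate_succ_apply'],
      show f^[2 ^ (j + 1)] x = f^[2 ^ j] (f^[2 ^ j] x) by
        rw [← Function.iterate_add_apply, pow_succ, mul_two],
      dist_iterate_iterate hmaps hf _ (hmaps hx) (hit _)] at e1
    have e2 := hX.pythagoras h₁ h₂ (h₁.1.proj_mem x) hzC
    rw [hX.dist_proj_proj h₁ h₂ (h₁.1.proj_mem _) (h₁.1.proj_mem _),
      hX.dist_proj_proj h₀ h₁ hx (hit _), hX.dist_iterate_two_pow h₀.1.convex hmaps hf hδ j x hx]
      at e2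
    have e3 := hX.pythagoras h₀ h₁ (hit (2 ^ (j + 1))) (h₁.1.proj_mem x)
    rw [hX.dist_proj_proj h₀ h₁ (hit _) hx, dist_comm _ x,
      hX.dist_iterate_two_pow h₀.1.convex hmaps hf hδ _ x hx] at e3
    obtain ⟨k, hk⟩ : ∃ k, 2 ^ j = k + 1 := ⟨2 ^ j - 1, by have := Nat.one_le_two_pow (n := j); omega⟩
    have hkR : (2 : ℝ) ^ j = k + 1 := by exact_mod_cast hk
    have e4 : dist (f x) (f^[2 ^ j] x) ≤ k * δ := by
      rw [hk, Function.iterate_succ_apply]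
      exact dist_iterate_le hmaps hδ k (hmaps hx)
    have e5 : dist (f x) (f^[2 ^ j] x) ^ 2 ≤ (k * δ) ^ 2 := by gcongr
    rw [show f^[2 ^ j] (f^[2 ^ j] x) = f^[2 ^ (j + 1)] x by
        rw [← Function.iterate_add_apply, pow_succ, mul_two]] at e1
    rw [e1, dist_comm z (proj C₁ x), e2, e3, pow_succ (2 : ℝ), hkR] at hbt
    rw [hkR]
    nlinarith [sq_nonneg (dist z m), sq_nonneg (Metric.infDist (f^[2 ^ (j + 1)] x) C₁)]
  by_contra hne
  have hpos : 0 < δ := dist_pos.2 (Ne.symm hne)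
  obtain ⟨n, hn⟩ := exists_nat_gt ((c ^ 2 + b ^ 2) / δ ^ 2)
  rw [div_lt_iff₀ (by positivity)] at hn
  have h1 := key n
  have h2 : (n : ℝ) ≤ 2 * 2 ^ n - 1 := by
    have : n < 2 ^ n := Nat.lt_two_pow_self
    have : (n : ℝ) + 1 ≤ 2 ^ n := by exact_mod_cast this
    linarith
  have h3 : (n : ℝ) * δ ^ 2 ≤ (2 * 2 ^ n - 1) * δ ^ 2 := by gcongr
  linarith

lemma proj_comp_proj {C₀ C₁ C₂ : Set X} (h₀ : Minimal (IsInvCC H) C₀)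
    (h₁ : Minimal (IsInvCC H) C₁) (h₂ : Minimal (IsInvCC H) C₂) {x : X} (hx : x ∈ C₀) :
    proj C₂ (proj C₁ x) = proj C₂ x := by
  have h := hX.proj_proj_proj h₀ h₁ h₂ hx
  have h' := hX.proj_proj h₂ h₀ (h₂.1.proj_mem (proj C₁ x))
  rw [← h', h]

/-- Leaves through a convergent sequence are Cauchy as parallel copies of `C 0`, since the distance
of two leaves is at most that of their points in the sequence. The limit of the projections embeds
`C 0` equivariantly onto a leaf through the limit point. -/
lemma isClosed_minUnion : IsClosed (minUnion X H) := by
  refine isClosed_of_closure_subset fun x hx => ?_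
  obtain ⟨u, hu, hux⟩ := mem_closure_iff_seq_limit.1 hx
  choose C hC huC using hu
  have hcauchy : ∀ y ∈ C 0, CauchySeq fun n => proj (C n) y := by
    intro y hy
    refine Metric.cauchySeq_iff.2 fun ε hε => ?_
    obtain ⟨N, hN⟩ := Metric.cauchySeq_iff.1 hux.cauchySeq ε hε
    refine ⟨N, fun m hm n hn => lt_of_le_of_lt ?_ (hN m hm n hn)⟩
    rw [← hX.proj_comp_proj (hC 0) (hC m) (hC n) hy, (hC n).1.dist_proj,
      hX.infDist_eq (hC m) (hC n).1 ((hC m).1.proj_mem y) (huC m)]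
    exact Metric.infDist_le_dist_of_mem (huC n)
  have hlim : ∀ y, ∃ l, y ∈ C 0 → Filter.Tendsto (fun n => proj (C n) y) Filter.atTop (nhds l) := by
    intro y
    by_cases hy : y ∈ C 0
    · obtain ⟨l, hl⟩ := cauchySeq_tendsto_of_complete (hcauchy y hy)
      exact ⟨l, fun _ => hl⟩
    · exact ⟨y, fun h => absurd h hy⟩
  choose f hf using hlim
  have hiso : ∀ a ∈ C 0, ∀ b ∈ C 0, dist (f a) (f b) = dist a b := fun a ha b hb =>
    tendsto_nhds_unique ((hf a ha).dist (hf b hb)) (by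
      simp only [hX.dist_proj_proj (hC 0) (hC _) ha hb]
      exact tendsto_const_nhds)
  have hequiv : ∀ h ∈ H, ∀ y ∈ C 0, f (h • y) = h • f y := fun h hh y hy =>
    tendsto_nhds_unique (hf _ ((hC 0).1.smul_mem h hh y hy)) (by
      simp only [hX.proj_smul_of_mem (hC _).1 hh]
      exact (hf y hy).const_smul h)
  refine ⟨f '' C 0, hX.minimal_image (hC 0) hiso hequiv, proj (C 0) x, (hC 0).1.proj_mem x, ?_⟩
  have h1 : Filter.Tendsto (fun n => proj (C n) (proj (C 0) (u n))) Filter.atTop (nhds x) := by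
    simpa only [hX.proj_proj (hC _) (hC 0) (huC _)] using hux
  refine tendsto_nhds_unique (hf _ ((hC 0).1.proj_mem x)) ?_
  refine (tendsto_iff_of_dist ?_).1 h1
  refine squeeze_zero (fun _ => dist_nonneg) (fun n => ?_) (tendsto_iff_dist_tendsto_zero.1 hux)
  exact (hX.dist_proj_le (hC n).1.toIsCC _ _).trans (hX.dist_proj_le (hC 0).1.toIsCC _ _)

/-- The midpoints of `z` and `proj C' z`, for `z` in `C`, form a minimal set halfway between the two
leaves. It contains the midpoint of `x` and `y`, over the midpoint `m` of `x` and `proj C y`. -/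
lemma midConvex_minUnion : MidConvex (minUnion X H) := by
  rintro x ⟨C, hC, hx⟩ y ⟨C', hC', hy⟩ q hq
  choose f hf using fun z => hX.exists_isMid z (proj C' z)
  set a := Metric.infDist x C'
  have ha : ∀ z ∈ C, Metric.infDist z C' = a := fun z hz => hX.infDist_eq hC hC'.1 hz hx
  have hfC : ∀ z ∈ C, dist z (f z) = a / 2 ∧ proj C (f z) = z := by
    intro z hz
    have h1 := hf z
    have hl := h1.left
    have hr := h1.right
    rw [hC'.1.dist_proj, ha z hz] at hl hr
    refine ⟨hl, (hX.eq_proj hC.1.toIsCC ⟨hz, fun c hc => ?_⟩).symm⟩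
    have h2 : a ≤ dist c (proj C' z) := by
      rw [← ha c hc]; exact Metric.infDist_le_dist_of_mem (hC'.1.proj_mem z)
    have h3 := dist_triangle c (f z) (proj C' z)
    rw [dist_comm (f z) z, hl, dist_comm (f z) c]
    rw [dist_comm (f z) (proj C' z), hr] at h3
    linarith
  have hiso : ∀ z ∈ C, ∀ w ∈ C, dist (f z) (f w) = dist z w := by
    intro z hz w hw
    apply le_antisymm
    · have := hX.dist_isMid_isMid (hf z) (hf w)
      rw [hX.dist_proj_proj hC hC' hz hw] at this
      linarith
    · have := hX.dist_proj_le hC.1.toIsCC (f z) (f w)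
      rwa [(hfC z hz).2, (hfC w hw).2] at this
  have hequiv : ∀ h ∈ H, ∀ z ∈ C, f (h • z) = h • f z := fun h hh z _ => by
    have h1 := hf (h • z)
    rw [hX.proj_smul_of_mem hC'.1 hh] at h1
    exact hX.isMid_unique h1 ((hf z).smul h)
  have hmin := hX.minimal_image hC hiso hequiv
  refine ⟨_, hmin, ?_⟩
  obtain ⟨m, hm⟩ := hX.exists_isMid x (proj C y)
  have hyC := hC.1.proj_mem y
  have hmC := hC.1.convex _ hx _ hyC _ hm
  have hxy := hX.pythagoras hC' hC hy hx
  rw [hX.infDist_comm hC' hC hy hx, dist_comm y x, dist_comm _ x] at hxy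
  have ham : dist m (proj C' m) = a := by rw [hC'.1.dist_proj, ha m hmC]
  have half_le : ∀ z, dist z m ^ 2 + dist z (proj C' m) ^ 2 ≤ 2 * dist x m ^ 2 + a ^ 2 →
      dist z (f m) ≤ dist x y / 2 := by
    intro z hz
    have h1 := hX.bruhat_tits_isMid (hf m) z
    rw [ham] at h1
    rw [hm.left] at hz
    refine abs_le_of_sq_le_sq' ?_ (by positivity) |>.2
    nlinarith
  have hfx : dist x (f m) ≤ dist x y / 2 := half_le x <| by
    have h1 := hX.pythagoras hC hC' hx (hC'.1.proj_mem m)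
    rw [hX.dist_proj_proj hC hC' hx hmC] at h1
    linarith
  have hfy : dist y (f m) ≤ dist x y / 2 := half_le y <| by
    have h1 := hX.pythagoras hC' hC hy hmC
    have h2 := hX.dist_proj_proj hC hC' hyC hmC
    rw [hX.proj_proj hC' hC hy] at h2
    rw [hX.infDist_comm hC' hC hy hx, hm.right, ← hm.left] at h1
    rw [h2, hm.right, ← hm.left]
    linarith
  have := dist_triangle x (f m) y
  rw [dist_comm (f m) y] at this
  exact ⟨m, hmC, hX.isMid_unique ⟨by linarith, by linarith⟩ hq⟩

end IsCATZero

end Parallel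

/-! ### Splitting for two commuting groups -/

section TwoFactors

universe u

variable {X : Type u} [MetricSpace X] {G : Type*} [Group G] [MulAction G X]

/-- A splitting of a set `U` as a product of `H`- and `K`-invariant sets `C` and `T`, with
coordinate projections `p` and `q`, such that `H` acts on the first factor only and `K` acts on
the second factor only. -/
structure IsSplitting (H K : Subgroup G) (U C T : Set X) (p q : X → X) : Prop where
  nonempty : T.Nonempty
  isClosed_union : IsClosed U
  midConvex_union : MidConvex U
  isClosed : IsClosed T
  midConvex : MidConvex T
  subset : T ⊆ U
  smul_union_left : ∀ h ∈ H, ∀ z ∈ U, h • z ∈ U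
  smul_union_right : ∀ k ∈ K, ∀ z ∈ U, k • z ∈ U
  smul_left : ∀ h ∈ H, ∀ c ∈ C, h • c ∈ C
  smul_right : ∀ k ∈ K, ∀ t ∈ T, k • t ∈ T
  fst_mem : ∀ z ∈ U, p z ∈ C
  snd_mem : ∀ z ∈ U, q z ∈ T
  dist_sq : ∀ z ∈ U, ∀ w ∈ U, dist z w ^ 2 = dist (p z) (p w) ^ 2 + dist (q z) (q w) ^ 2
  exists_eq : ∀ c ∈ C, ∀ t ∈ T, ∃ z ∈ U, p z = c ∧ q z = t
  fst_smul_left : ∀ h ∈ H, ∀ z ∈ U, p (h • z) = h • p z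
  snd_smul_left : ∀ h ∈ H, ∀ z ∈ U, q (h • z) = q z
  fst_smul_right : ∀ k ∈ K, ∀ z ∈ U, p (k • z) = p z
  snd_smul_right : ∀ k ∈ K, ∀ z ∈ U, q (k • z) = k • q z
  snd_eq : ∀ t ∈ T, q t = t
  fst_eq : ∀ t ∈ T, ∀ t' ∈ T, p t = p t'

/-- Midpoints in a product have midpoints as coordinates (numerical core). -/
lemma half_of_sq_add_sq {a a₁ a₂ b b₁ b₂ d d₁ d₂ : ℝ} (hd₁ : d₁ = d / 2) (hd₂ : d₂ = d / 2)
    (h : d ^ 2 = a ^ 2 + b ^ 2) (h₁ : d₁ ^ 2 = a₁ ^ 2 + b₁ ^ 2) (h₂ : d₂ ^ 2 = a₂ ^ 2 + b₂ ^ 2)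
    (ha : a ≤ a₁ + a₂) (hb : b ≤ b₁ + b₂) (ha0 : 0 ≤ a) (hb0 : 0 ≤ b) :
    (a₁ = a / 2 ∧ a₂ = a / 2) ∧ (b₁ = b / 2 ∧ b₂ = b / 2) := by
  subst hd₁ hd₂
  have ea : a ^ 2 ≤ (a₁ + a₂) ^ 2 := by gcongr
  have eb : b ^ 2 ≤ (b₁ + b₂) ^ 2 := by gcongr
  -- By the parallelogram identity `(a₁ - a₂) ^ 2 + (b₁ - b₂) ^ 2` equals `d ^ 2 - (a₁ + a₂) ^ 2 -
  -- (b₁ + b₂) ^ 2`, which is at most 0.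
  have e1 : (a₁ - a₂) ^ 2 = 0 := le_antisymm (by nlinarith [sq_nonneg (b₁ - b₂)]) (sq_nonneg _)
  have e2 : (b₁ - b₂) ^ 2 = 0 := le_antisymm (by nlinarith [sq_nonneg (a₁ - a₂)]) (sq_nonneg _)
  have e1' : a₁ = a₂ := sub_eq_zero.1 (pow_eq_zero_iff two_ne_zero |>.1 e1)
  have e2' : b₁ = b₂ := sub_eq_zero.1 (pow_eq_zero_iff two_ne_zero |>.1 e2)
  subst e1' e2'
  have e3 : a₁ ^ 2 = (a / 2) ^ 2 := le_antisymm (by nlinarith) (by nlinarith)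
  have e4 : b₁ ^ 2 = (b / 2) ^ 2 := by nlinarith
  have e5 := (sq_eq_sq₀ (by linarith) (by linarith)).1 e3
  have e6 := (sq_eq_sq₀ (by linarith) (by linarith)).1 e4
  exact ⟨⟨e5, e5⟩, e6, e6⟩

lemma isMid_of_dist_sq {U : Set X} {p q : X → X}
    (h : ∀ z ∈ U, ∀ w ∈ U, dist z w ^ 2 = dist (p z) (p w) ^ 2 + dist (q z) (q w) ^ 2)
    {m x y : X} (hm : IsMid m x y) (hmU : m ∈ U) (hx : x ∈ U) (hy : y ∈ U) :
    IsMid (p m) (p x) (p y) ∧ IsMid (q m) (q x) (q y) := by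
  have ha := dist_triangle (p x) (p m) (p y)
  have hb := dist_triangle (q x) (q m) (q y)
  rw [dist_comm (p m)] at ha
  rw [dist_comm (q m)] at hb
  obtain ⟨⟨h1, h2⟩, h3, h4⟩ := half_of_sq_add_sq hm.left hm.right (h _ hx _ hy) (h _ hx _ hmU)
    (h _ hy _ hmU) ha hb dist_nonneg dist_nonneg
  exact ⟨⟨h1, h2⟩, ⟨h3, h4⟩⟩

variable [ProperSpace X] [IsIsometricSMul G X]

namespace IsCATZero

variable (hX : IsCATZero X) {H K : Subgroup G} (hcomm : ∀ h ∈ H, ∀ k ∈ K, h * k = k * h)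
include hX hcomm

lemma minimal_smul_image {C : Set X} (hC : Minimal (IsInvCC H) C) {k : G} (hk : k ∈ K) :
    Minimal (IsInvCC H) ((fun x => k • x) '' C) :=
  hX.minimal_image hC (fun a _ b _ => dist_smul k a b)
    fun h hh x _ => by rw [smul_smul, ← hcomm h hh k hk, mul_smul]

/-- If unbounded sets have unbounded displacement, then elements commuting with `H` do not
translate along the minimal `H`-invariant sets. -/
lemma proj_smul_eq_self
    (hbd : ∀ S : Set X, (∀ h ∈ H, ∃ B : ℝ, ∀ x ∈ S, dist (h • x) x ≤ B) →
      (∀ k ∈ K, ∃ B : ℝ, ∀ x ∈ S, dist (k • x) x ≤ B) → Bornology.IsBounded S)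
    {C : Set X} (hC : Minimal (IsInvCC H) C) {k : G} (hk : k ∈ K) {x : X} (hx : x ∈ C) :
    proj C (k • x) = x := by
  have hkC := hX.minimal_smul_image hcomm hC hk
  set f : X → X := fun x => proj C (k • x) with hfdef
  have hmaps : Set.MapsTo f C C := fun x _ => hC.1.proj_mem _
  have hf : ∀ a ∈ C, ∀ b ∈ C, dist (f a) (f b) = dist a b := fun a ha b hb => by
    rw [hfdef, hX.dist_proj_proj hkC hC ⟨a, ha, rfl⟩ ⟨b, hb, rfl⟩, dist_smul]
  have hcont : Continuous f :=
    (hX.continuous_proj hC.1.toIsCC).comp (isometry_smul X k).continuous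
  have hequiv : ∀ h ∈ H, ∀ x ∈ C, f (h • x) = h • f x := fun h hh x _ => by
    simp only [hfdef]
    rw [smul_smul, ← hcomm h hh k hk, mul_smul, hX.proj_smul_of_mem hC.1 hh]
  set δ := dist x (f x) with hδdef
  have hδ : ∀ y ∈ C, dist y (f y) = δ := fun y hy =>
    hX.dist_map_eq_of_minimal hC hcont hf hequiv hy hx
  have hequiv_iter : ∀ h ∈ H, ∀ n, f^[n] (h • x) = h • f^[n] x := by
    intro h hh n
    induction n with
    | zero => rfl
    | succ n ih =>
      rw [Function.iterate_succ_apply', ih, hequiv h hh _ (hmaps.iterate n hx),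
        Function.iterate_succ_apply']
  -- Elements of H have constant displacement on the orbit because `f` is equivariant and isometric;
  -- elements of K because their displacement is an H-invariant quasi-convex function on a minimal
  -- set.
  have hb : Bornology.IsBounded (Set.range fun n => f^[n] x) := by
    apply hbd
    · intro h hh
      refine ⟨dist (h • x) x, ?_⟩
      rintro _ ⟨n, rfl⟩
      change dist (h • f^[n] x) (f^[n] x) ≤ _
      rw [← hequiv_iter h hh n,
        dist_iterate_iterate hmaps hf n (hC.1.smul_mem h hh x hx) hx]
    · intro k' hk'
      refine ⟨dist (k' • x) x, ?_⟩
      rintro _ ⟨n, rfl⟩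
      refine (eq_of_minimal hC (f := fun y => dist (k' • y) y)
        ((isometry_smul X k').continuous.dist continuous_id) (fun y _ z _ m _ hm => ?_)
        (fun h hh y _ => ?_) (hmaps.iterate n hx) hx).le
      · exact Set.mem_ofPred.1 (hX.midConvex_displacement k' _ y
          (Set.mem_ofPred.2 (le_max_left _ _)) z (Set.mem_ofPred.2 (le_max_right _ _)) m hm)
      · simp only [smul_smul]
        rw [← hcomm h hh k' hk', mul_smul, dist_smul]
  obtain ⟨R, hR⟩ := hb.subset_closedBall x
  by_contra hne
  have hpos : 0 < δ := dist_pos.2 (Ne.symm hne)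
  obtain ⟨n, hn⟩ := exists_nat_gt (R / δ)
  rw [div_lt_iff₀ hpos] at hn
  have h1 := hX.dist_iterate_two_pow hC.1.convex hmaps hf hδ n x hx
  have h2 : dist (f^[2 ^ n] x) x ≤ R := hR ⟨_, rfl⟩
  rw [dist_comm, h1] at h2
  have h3 : (n : ℝ) ≤ 2 ^ n := by exact_mod_cast (Nat.lt_two_pow_self (n := n)).le
  have h4 : (n : ℝ) * δ ≤ 2 ^ n * δ := by gcongr
  linarith

/-- The splitting theorem for two commuting groups. -/
theorem exists_isSplitting [Nonempty X]
    (hbd : ∀ S : Set X, (∀ h ∈ H, ∃ B : ℝ, ∀ x ∈ S, dist (h • x) x ≤ B) →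
      (∀ k ∈ K, ∃ B : ℝ, ∀ x ∈ S, dist (k • x) x ≤ B) → Bornology.IsBounded S) :
    ∃ (U C T : Set X) (p q : X → X), IsSplitting H K U C T p q := by
  obtain ⟨C, hC⟩ := hX.exists_minimal hcomm hbd
  obtain ⟨x₀, hx₀⟩ := hC.1.nonempty
  have hleaf : ∀ z, ∃ D : Set X, z ∈ minUnion X H → Minimal (IsInvCC H) D ∧ z ∈ D := by
    intro z
    by_cases hz : z ∈ minUnion X H
    · obtain ⟨D, hD⟩ := hz
      exact ⟨D, fun _ => hD⟩
    · exact ⟨∅, fun h => absurd h hz⟩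
  choose L hL using hleaf
  set U := minUnion X H
  have hLmin : ∀ z ∈ U, Minimal (IsInvCC H) (L z) := fun z hz => (hL z hz).1
  have hLmem : ∀ z ∈ U, z ∈ L z := fun z hz => (hL z hz).2
  have hLeq : ∀ z ∈ U, ∀ {D : Set X}, Minimal (IsInvCC H) D → z ∈ D → L z = D :=
    fun z hz D hD hzD => minimal_eq_of_mem (hLmin z hz) hD (hLmem z hz) hzD
  have hU : ∀ {D : Set X}, Minimal (IsInvCC H) D → D ⊆ U := fun {D} hD z hz => ⟨D, hD, hz⟩
  set p : X → X := proj C with hp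
  set q : X → X := fun z => proj (L z) x₀ with hq
  -- `T` meets each leaf in exactly one point, namely `q z` for the leaf through `z`.
  set T : Set X := U ∩ {t | p t = x₀} with hT
  have hpC : ∀ z, p z ∈ C := fun z => hC.1.proj_mem z
  have hqL : ∀ z ∈ U, q z ∈ L z := fun z hz => (hLmin z hz).1.proj_mem x₀
  have hqU : ∀ z ∈ U, q z ∈ U := fun z hz => hU (hLmin z hz) (hqL z hz)
  have hpq : ∀ z ∈ U, p (q z) = x₀ := fun z hz => hX.proj_proj hC (hLmin z hz) hx₀
  have hqT : ∀ z ∈ U, q z ∈ T := fun z hz => ⟨hqU z hz, Set.mem_ofPred.2 (hpq z hz)⟩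
  have hproj_p : ∀ z ∈ U, proj (L z) (p z) = z := fun z hz =>
    hX.proj_proj (hLmin z hz) hC (hLmem z hz)
  have hq_unique : ∀ z ∈ U, ∀ t ∈ L z, p t = x₀ → q z = t := fun z hz t ht hpt => by
    have := hX.proj_proj (hLmin z hz) hC ht
    rwa [← hp, hpt] at this
  have hdist : ∀ z ∈ U, ∀ w ∈ U,
      dist z w ^ 2 = dist (p z) (p w) ^ 2 + dist (q z) (q w) ^ 2 := by
    intro z hz w hw
    have hzm := hLmin z hz
    have hwm := hLmin w hw
    -- The height between the leaves of `z` and `w` is `dist (q z) (q w)`, and the horizontal part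
    -- is carried to `C` isometrically; both identifications rest on the trivial holonomy.
    rw [hX.pythagoras hzm hwm (hLmem z hz) (hLmem w hw),
      hX.infDist_eq hzm hwm.1 (hLmem z hz) (hqL z hz), ← hwm.1.dist_proj,
      hX.proj_comp_proj hC hzm hwm hx₀,
      ← hX.dist_proj_proj hwm hC (hwm.1.proj_mem z) (hLmem w hw),
      hX.proj_comp_proj hzm hwm hC (hLmem z hz)]
  have hsmulH : ∀ h ∈ H, ∀ z ∈ U, h • z ∈ U := fun h hh z hz =>
    hU (hLmin z hz) ((hLmin z hz).1.smul_mem h hh z (hLmem z hz))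
  have hLH : ∀ h ∈ H, ∀ z ∈ U, L (h • z) = L z := fun h hh z hz =>
    hLeq _ (hsmulH h hh z hz) (hLmin z hz) ((hLmin z hz).1.smul_mem h hh z (hLmem z hz))
  have hkL : ∀ k ∈ K, ∀ z ∈ U, Minimal (IsInvCC H) ((fun x => k • x) '' L z) :=
    fun k hk z hz => hX.minimal_smul_image hcomm (hLmin z hz) hk
  have hsmulK : ∀ k ∈ K, ∀ z ∈ U, k • z ∈ U := fun k hk z hz =>
    hU (hkL k hk z hz) ⟨z, hLmem z hz, rfl⟩
  have hLK : ∀ k ∈ K, ∀ z ∈ U, L (k • z) = (fun x => k • x) '' L z := fun k hk z hz =>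
    hLeq _ (hsmulK k hk z hz) (hkL k hk z hz) ⟨z, hLmem z hz, rfl⟩
  have hpK : ∀ k ∈ K, ∀ z ∈ U, p (k • z) = p z := by
    intro k hk z hz
    have hkC := hX.minimal_smul_image hcomm hC hk
    -- By trivial holonomy, projecting `k • z` to `C` amounts to projecting `k • p z` to `C`, which
    -- returns `p z` as `k` does not translate along `C`.
    have h1 : proj ((fun x => k • x) '' L z) (k • p z) = k • z := by
      rw [hX.proj_smul (hLmin z hz).1.toIsCC (hkL k hk z hz).1.toIsCC, hproj_p z hz]
      exact fun x => (MulAction.injective k).mem_set_image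
    rw [← h1, hp, hX.proj_comp_proj hkC (hkL k hk z hz) hC ⟨p z, hpC z, rfl⟩]
    exact hX.proj_smul_eq_self hcomm hbd hC hk (hpC z)
  have hTK : ∀ k ∈ K, ∀ t ∈ T, k • t ∈ T := fun k hk t ht =>
    ⟨hsmulK k hk t ht.1, Set.mem_ofPred.2 ((hpK k hk t ht.1).trans (Set.mem_ofPred.1 ht.2))⟩
  refine ⟨U, C, T, p, q,
    { nonempty := ⟨q x₀, hqT _ (hU hC hx₀)⟩
      isClosed_union := hX.isClosed_minUnion
      midConvex_union := hX.midConvex_minUnion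
      isClosed := hX.isClosed_minUnion.inter
        (isClosed_eq (hX.continuous_proj hC.1.toIsCC) continuous_const)
      midConvex := ?_
      subset := Set.inter_subset_left
      smul_union_left := hsmulH
      smul_union_right := hsmulK
      smul_left := hC.1.smul_mem
      smul_right := hTK
      fst_mem := fun z _ => hpC z
      snd_mem := hqT
      dist_sq := hdist
      exists_eq := ?_
      fst_smul_left := fun h hh z _ => hX.proj_smul_of_mem hC.1 hh z
      snd_smul_left := fun h hh z hz => by simp only [hq, hLH h hh z hz]
      fst_smul_right := hpK
      snd_smul_right := ?_
      snd_eq := fun t ht => hq_unique t ht.1 t (hLmem t ht.1) (Set.mem_ofPred.1 ht.2)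
      fst_eq := fun t ht t' ht' =>
        (Set.mem_ofPred.1 ht.2).trans (Set.mem_ofPred.1 ht'.2).symm }⟩
  · intro a ha b hb m hm
    have hmU := hX.midConvex_minUnion a ha.1 b hb.1 m hm
    have h1 := (isMid_of_dist_sq hdist hm hmU ha.1 hb.1).1
    rw [Set.mem_ofPred.1 ha.2, Set.mem_ofPred.1 hb.2] at h1
    exact ⟨hmU, Set.mem_ofPred.2 (hX.isMid_unique h1 (isMid_self x₀))⟩
  · intro c hc t ht
    have hm := hLmin t ht.1
    have hz : proj (L t) c ∈ L t := hm.1.proj_mem c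
    have hLz := hLeq _ (hU hm hz) hm hz
    refine ⟨proj (L t) c, hU hm hz, hX.proj_proj hC hm hc, ?_⟩
    apply hq_unique _ (hU hm hz) _ _ (Set.mem_ofPred.1 ht.2)
    rw [hLz]
    exact hLmem t ht.1
  · intro k hk z hz
    apply hq_unique _ (hsmulK k hk z hz)
    · rw [hLK k hk z hz]
      exact ⟨q z, hqL z hz, rfl⟩
    · rw [hpK k hk _ (hqU z hz), hpq z hz]

end IsCATZero

end TwoFactors

/-! ### Convex subspaces -/

section Subspaces

universe u

variable {X : Type u} [MetricSpace X]

/-- Convex subsets of CAT(0) spaces are CAT(0). -/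
lemma IsCATZero.subtype (hX : IsCATZero X) {T : Set X} (hT : IsConvex T) : IsCATZero T where
  geodesic x y := by
    obtain ⟨σ, hσ⟩ := hX.geodesic x y
    have hmem := hT x x.2 y y.2 σ hσ
    have hle : (0 : ℝ) ≤ dist x y := dist_nonneg
    -- Segments are total functions on `ℝ`; clamping the parameter keeps the values in `T`.
    refine ⟨fun t => ⟨σ (Set.projIcc 0 (dist x y) hle t), hmem _ (Subtype.prop _)⟩, ?_, ?_, ?_⟩
    · intro s hs t ht
      rw [Subtype.dist_eq]
      simp only [Set.projIcc_of_mem hle hs, Set.projIcc_of_mem hle ht]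
      exact hσ.isometric s hs t ht
    · apply Subtype.ext
      simp only [Set.projIcc_left]
      exact hσ.source
    · apply Subtype.ext
      simp only [Set.projIcc_right]
      exact hσ.target
  bruhat_tits x c c' σ hσ :=
    hX.bruhat_tits x c c' (fun t => σ t) ⟨hσ.isometric, congrArg _ hσ.source, congrArg _ hσ.target⟩

end Subspaces

/-! ### Finite products and the induction -/

section Products

universe u v

variable {n : ℕ} {G : Fin (n + 1) → Type v} [∀ i, Group (G i)]

variable (G) in
/-- The first factor as a subgroup of the product. -/
def headSubgroup : Subgroup (∀ i, G i) where
  carrier := {g | ∀ i : Fin n, g i.succ = 1}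
  mul_mem' := fun {a b} ha hb => Set.mem_ofPred.2 fun i => by
    rw [Pi.mul_apply, Set.mem_ofPred.1 ha i, Set.mem_ofPred.1 hb i, one_mul]
  one_mem' := Set.mem_ofPred.2 fun _ => rfl
  inv_mem' := fun {a} ha => Set.mem_ofPred.2 fun i => by
    rw [Pi.inv_apply, Set.mem_ofPred.1 ha i, inv_one]

variable (G) in
/-- The product of all factors but the first as a subgroup of the product. -/
def tailSubgroup : Subgroup (∀ i, G i) where
  carrier := {g | g 0 = 1}
  mul_mem' := fun {a b} ha hb => Set.mem_ofPred.2 <| by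
    rw [Pi.mul_apply, Set.mem_ofPred.1 ha, Set.mem_ofPred.1 hb, one_mul]
  one_mem' := Set.mem_ofPred.2 rfl
  inv_mem' := fun {a} ha => Set.mem_ofPred.2 <| by
    rw [Pi.inv_apply, Set.mem_ofPred.1 ha, inv_one]

variable (G) in
/-- The inclusion of the first factor. -/
def headHom : G 0 →* ∀ i, G i where
  toFun a := Fin.cons a fun _ => 1
  map_one' := funext fun i => by cases i using Fin.cases <;> rfl
  map_mul' a b := funext fun i => by cases i using Fin.cases <;> simp

variable (G) in
/-- The inclusion of the product of all factors but the first. -/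
def tailHom : (∀ i : Fin n, G i.succ) →* ∀ i, G i where
  toFun a := Fin.cons 1 a
  map_one' := funext fun i => by cases i using Fin.cases <;> rfl
  map_mul' a b := funext fun i => by cases i using Fin.cases <;> simp

lemma headHom_mem (a : G 0) : headHom G a ∈ headSubgroup G := fun _ => rfl

lemma tailHom_mem (a : ∀ i : Fin n, G i.succ) : tailHom G a ∈ tailSubgroup G := rfl

lemma headHom_mul_tailHom (g : ∀ i, G i) : headHom G (g 0) * tailHom G (fun i => g i.succ) = g :=
  funext fun i => by cases i using Fin.cases <;> simp [headHom, tailHom]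

lemma head_mul_tail_comm : ∀ h ∈ headSubgroup G, ∀ k ∈ tailSubgroup G, h * k = k * h := by
  intro h hh k hk
  funext i
  cases i using Fin.cases with
  | zero => rw [Pi.mul_apply, Pi.mul_apply, Set.mem_ofPred.1 hk, one_mul, mul_one]
  | succ i => rw [Pi.mul_apply, Pi.mul_apply, Set.mem_ofPred.1 hh i, one_mul, mul_one]

variable {X : Type u} [MetricSpace X] [MulAction (∀ i, G i) X] [IsIsometricSMul (∀ i, G i) X]

/-- A product decomposition of a `G`-space into a `G 0`-space and a space that splits under the
remaining factors is a splitting. -/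
lemma splitsEquivariantly_succ {Z C T : Type u} [MetricSpace Z] [MulAction (∀ i, G i) Z]
    [MetricSpace C] [MulAction (G 0) C] [IsIsometricSMul (G 0) C]
    [MetricSpace T] [MulAction (∀ i : Fin n, G i.succ) T]
    (hT : SplitsEquivariantly (fun i : Fin n => G i.succ) T) (e : Z ≃ C × T)
    (hdist : ∀ z w, dist z w ^ 2 = dist (e z).1 (e w).1 ^ 2 + dist (e z).2 (e w).2 ^ 2)
    (hfst : ∀ (g : ∀ i, G i) z, (e (g • z)).1 = g 0 • (e z).1)
    (hsnd : ∀ (g : ∀ i, G i) z, (e (g • z)).2 = (fun i : Fin n => g i.succ) • (e z).2) :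
    SplitsEquivariantly G Z := by
  obtain ⟨Y, hY, hact, hiso, φ, hφ, hequiv⟩ := hT
  let Y' : Fin (n + 1) → Type u := Fin.cons C Y
  let hY' : ∀ i, MetricSpace (Y' i) :=
    Fin.cases (motive := fun i => MetricSpace (Y' i)) ‹MetricSpace C› hY
  let hact' : ∀ i, MulAction (G i) (Y' i) :=
    Fin.cases (motive := fun i => MulAction (G i) (Y' i)) ‹MulAction (G 0) C› hact
  have hiso' : ∀ i, IsIsometricSMul (G i) (Y' i) :=
    Fin.cases (motive := fun i => IsIsometricSMul (G i) (Y' i))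
      ‹IsIsometricSMul (G 0) C› hiso
  let ψ : Z ≃ ∀ i, Y' i :=
    { toFun := fun z => Fin.cases (motive := Y') (e z).1 (φ (e z).2)
      invFun := fun y => e.symm (y 0, φ.symm fun i => y i.succ)
      left_inv := fun z => e.symm_apply_eq.2 (Prod.ext rfl (φ.symm_apply_eq.2 rfl))
      right_inv := fun y => by
        funext i
        cases i using Fin.cases with
        | zero =>
          change (e (e.symm (y 0, φ.symm fun i => y i.succ))).1 = y 0
          rw [e.apply_symm_apply]
        | succ i =>
          change φ (e (e.symm (y 0, φ.symm fun i => y i.succ))).2 i = y i.succ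
          rw [e.apply_symm_apply]
          exact congrFun (φ.apply_symm_apply fun i => y i.succ) i }
  refine ⟨Y', hY', hact', hiso', ψ, fun z w => ?_, fun g z i => ?_⟩
  · rw [hdist, hφ, Fin.sum_univ_succ]
    rfl
  · cases i using Fin.cases with
    | zero => exact hfst g z
    | succ i =>
      have h := congrFun (congrArg φ (hsnd g z)) i
      exact h.trans (hequiv _ _ i)

/-- Group family and space are quantified after the colon because the induction hypothesis is used
for the remaining factors acting on the fibre `T`. -/
theorem exists_fixedPoint_or_splits {n : ℕ} : ∀ (G : Fin n → Type v) [∀ i, Group (G i)]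
    (X : Type u) [MetricSpace X] [ProperSpace X] [Nonempty X] (_ : IsCATZero X)
    [MulAction (∀ i, G i) X] [IsIsometricSMul (∀ i, G i) X],
    (∃ ξ : Boundary X, ∀ g : ∀ i, G i, g • ξ = ξ) ∨
      ∃ Z : SubMulAction (∀ i, G i) X,
        (Z : Set X).Nonempty ∧ IsClosed (Z : Set X) ∧ IsConvex (Z : Set X) ∧
          SplitsEquivariantly G Z := by
  induction n with
  | zero =>
    intro G _ X _ _ _ hX _ _
    obtain ⟨x⟩ := ‹Nonempty X›
    refine Or.inr ⟨⟨{x}, fun g y hy => ?_⟩, ⟨x, rfl⟩, isClosed_singleton, ?_, ?_⟩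
    · rwa [Subsingleton.elim g 1, one_smul]
    · refine MidConvex.isConvex ?_ isClosed_singleton
      rintro a rfl b rfl m hm
      have := hm.left
      rw [dist_self, zero_div, dist_eq_zero] at this
      exact this.symm
    · refine ⟨fun _ => PUnit, fun _ => inferInstance, fun i => i.elim0, fun i => i.elim0,
        ⟨fun _ i => i.elim0, fun _ => ⟨x, rfl⟩, ?_, fun _ => funext fun i => i.elim0⟩,
        ?_, fun _ _ i => i.elim0⟩
      · rintro ⟨y, rfl⟩
        rfl
      · rintro ⟨y, rfl⟩ ⟨z, rfl⟩
        simp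
  | succ n ih =>
    intro G _ X _ _ _ hX _ _
    by_cases hfix : ∃ ξ : Boundary X, ∀ g : ∀ i, G i, g • ξ = ξ
    · exact Or.inl hfix
    right
    have hbd : ∀ S : Set X, (∀ h ∈ headSubgroup G, ∃ B : ℝ, ∀ x ∈ S, dist (h • x) x ≤ B) →
        (∀ k ∈ tailSubgroup G, ∃ B : ℝ, ∀ x ∈ S, dist (k • x) x ≤ B) →
        Bornology.IsBounded S := by
      intro S hh hk
      refine hX.isBounded_of_bounded_displacement hfix fun g => ?_
      obtain ⟨B, hB⟩ := hh _ (headHom_mem (g 0))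
      obtain ⟨B', hB'⟩ := hk _ (tailHom_mem fun i => g i.succ)
      refine ⟨B' + B, fun x hx => ?_⟩
      rw [← headHom_mul_tailHom g, mul_smul]
      refine (dist_triangle _ (headHom G (g 0) • x) _).trans ?_
      rw [dist_smul]
      exact add_le_add (hB' x hx) (hB x hx)
    obtain ⟨U, C, T, p, q, hs⟩ := hX.exists_isSplitting head_mul_tail_comm hbd
    have hTne : Nonempty T := hs.nonempty.to_subtype
    have hTproper : ProperSpace T := ProperSpace.of_isClosed hs.isClosed
    let actT : MulAction (∀ i : Fin n, G i.succ) T :=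
      { smul := fun g t => ⟨tailHom G g • (t : X), hs.smul_right _ (tailHom_mem g) t t.2⟩
        one_smul := fun t => Subtype.ext (by
          change tailHom G 1 • (t : X) = t
          rw [map_one, one_smul])
        mul_smul := fun g h t => Subtype.ext (by
          change tailHom G (g * h) • (t : X) = tailHom G g • tailHom G h • (t : X)
          rw [map_mul, mul_smul]) }
    have isoT : IsIsometricSMul (∀ i : Fin n, G i.succ) T :=
      ⟨fun g => Isometry.of_dist_eq fun s t => dist_smul (tailHom G g) (s : X) t⟩
    let actC : MulAction (G 0) C :=
      { smul := fun g t => ⟨headHom G g • (t : X), hs.smul_left _ (headHom_mem g) t t.2⟩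
        one_smul := fun t => Subtype.ext (by
          change headHom G 1 • (t : X) = t
          rw [map_one, one_smul])
        mul_smul := fun g h t => Subtype.ext (by
          change headHom G (g * h) • (t : X) = headHom G g • headHom G h • (t : X)
          rw [map_mul, mul_smul]) }
    have isoC : IsIsometricSMul (G 0) C :=
      ⟨fun g => Isometry.of_dist_eq fun s t => dist_smul (headHom G g) (s : X) t⟩
    have hp : ∀ (g : ∀ i, G i), ∀ z ∈ U, p (g • z) = headHom G (g 0) • p z := fun g z hz => by
      conv_lhs => rw [← headHom_mul_tailHom g, mul_smul]
      rw [hs.fst_smul_left _ (headHom_mem _) _ (hs.smul_union_right _ (tailHom_mem _) _ hz),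
        hs.fst_smul_right _ (tailHom_mem _) _ hz]
    have hq : ∀ (g : ∀ i, G i), ∀ z ∈ U, q (g • z) = tailHom G (fun i => g i.succ) • q z :=
      fun g z hz => by
        conv_lhs => rw [← headHom_mul_tailHom g, mul_smul]
        rw [hs.snd_smul_left _ (headHom_mem _) _ (hs.smul_union_right _ (tailHom_mem _) _ hz),
          hs.snd_smul_right _ (tailHom_mem _) _ hz]
    have hgU : ∀ (g : ∀ i, G i), ∀ z ∈ U, g • z ∈ U := fun g z hz => by
      rw [← headHom_mul_tailHom g, mul_smul]
      exact hs.smul_union_left _ (headHom_mem _) _ (hs.smul_union_right _ (tailHom_mem _) _ hz)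
    rcases ih (fun i => G i.succ) T (hX.subtype (hs.midConvex.isConvex hs.isClosed)) with
      ⟨ξ, hξ⟩ | ⟨Z', hne, hcl, hconv, hsplit⟩
    · exfalso
      apply hfix
      induction ξ using Quotient.inductionOn with
      | h r =>
        refine ⟨Quotient.mk (asymptotic X)
          ⟨fun t => (r.1 t : X), isometry_subtype_coe.comp r.2⟩, fun g => Quotient.sound ?_⟩
        obtain ⟨B, hB⟩ := Quotient.exact (hξ fun i => g i.succ)
        let t₀ : X := r.1 0
        -- As `p` is constant on `T`, the head of `g` contributes the same displacement at every
        -- point of the ray; the tail contributes at most `B`.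
        refine ⟨dist (headHom G (g 0) • p t₀) (p t₀) + B, fun t => ?_⟩
        change dist (g • (r.1 t : X)) (r.1 t) ≤ _
        have ht := (r.1 t).2
        have h1 := hs.dist_sq _ (hgU g _ (hs.subset ht)) _ (hs.subset ht)
        rw [hp g _ (hs.subset ht), hq g _ (hs.subset ht), hs.snd_eq _ ht,
          hs.fst_eq _ ht t₀ (r.1 0).2] at h1
        have h2 : dist (tailHom G (fun i => g i.succ) • (r.1 t : X)) (r.1 t) ≤ B := hB t
        have h3 : 0 ≤ dist (headHom G (g 0) • p t₀) (p t₀) := dist_nonneg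
        have h4 : 0 ≤ dist (tailHom G (fun i => g i.succ) • (r.1 t : X)) (r.1 t) := dist_nonneg
        refine (abs_le_of_sq_le_sq' ?_ (add_nonneg h3 h4)).2.trans (by linarith)
        rw [h1]
        nlinarith [mul_nonneg h3 h4]
    · let Q : U → T := fun z => ⟨q z, hs.snd_mem z z.2⟩
      have hQ : Continuous Q := (LipschitzWith.of_dist_le_mul (K := 1) fun z w => by
        rw [NNReal.coe_one, one_mul]
        refine (abs_le_of_sq_le_sq' ?_ dist_nonneg).2
        change dist (q z) (q w) ^ 2 ≤ dist (z : X) w ^ 2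
        rw [hs.dist_sq z z.2 w w.2]
        exact le_add_of_nonneg_left (sq_nonneg _)).continuous
      have hconv' := (hX.subtype (hs.midConvex.isConvex hs.isClosed)).midConvex_of_isConvex hconv
      let Z : SubMulAction (∀ i, G i) X :=
        -- In product coordinates this is `C × Z'`.
        { carrier := Subtype.val '' (Q ⁻¹' (Z' : Set T))
          smul_mem' := by
            rintro g _ ⟨z, hz, rfl⟩
            refine ⟨⟨g • (z : X), hgU g z z.2⟩, ?_, rfl⟩
            have h1 : Q ⟨g • (z : X), hgU g z z.2⟩ = (fun i : Fin n => g i.succ) • Q z :=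
              Subtype.ext (hq g z z.2)
            change Q ⟨g • (z : X), hgU g z z.2⟩ ∈ Z'
            rw [h1]
            exact Z'.smul_mem _ hz }
      have hZcl : IsClosed (Z : Set X) :=
        hs.isClosed_union.isClosedEmbedding_subtypeVal.isClosedMap _ (hcl.preimage hQ)
      have hZU : ∀ z ∈ Z, z ∈ U := by
        rintro _ ⟨z, -, rfl⟩
        exact z.2
      have hZQ : ∀ z, ∀ hz : z ∈ Z, Q ⟨z, hZU z hz⟩ ∈ Z' := by
        rintro _ ⟨z, hz, rfl⟩
        exact hz
      refine ⟨Z, ?_, hZcl, MidConvex.isConvex ?_ hZcl, ?_⟩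
      · obtain ⟨t, ht⟩ := hne
        refine ⟨t, ⟨t, hs.subset t.2⟩, ?_, rfl⟩
        have h1 : Q ⟨t, hs.subset t.2⟩ = t := Subtype.ext (hs.snd_eq t t.2)
        rw [Set.mem_preimage, h1]
        exact ht
      · intro a ha b hb m hm
        have haU := hZU a ha
        have hbU := hZU b hb
        have hmU := hs.midConvex_union a haU b hbU m hm
        have h1 := (isMid_of_dist_sq hs.dist_sq hm hmU haU hbU).2
        exact ⟨⟨m, hmU⟩, hconv' _ (hZQ a ha) _ (hZQ b hb) (Q ⟨m, hmU⟩) ⟨h1.left, h1.right⟩, rfl⟩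
      · let f : Z → C × Z' := fun z =>
          (⟨p z, hs.fst_mem z (hZU z z.2)⟩, ⟨Q ⟨z, hZU z z.2⟩, hZQ z z.2⟩)
        have hdist : ∀ z w : Z, dist z w ^ 2 =
            dist (f z).1 (f w).1 ^ 2 + dist (f z).2 (f w).2 ^ 2 := fun z w =>
          hs.dist_sq z (hZU z z.2) w (hZU w w.2)
        have hf : Function.Bijective f := by
          constructor
          · intro z w h
            have h1 := hdist z w
            rw [h, dist_self, dist_self] at h1
            exact dist_eq_zero.1 (pow_eq_zero_iff two_ne_zero |>.1 (by linarith))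
          · rintro ⟨c, t⟩
            obtain ⟨z, hzU, hpz, hqz⟩ := hs.exists_eq c c.2 t.1 t.1.2
            have h1 : Q ⟨z, hzU⟩ = t.1 := Subtype.ext hqz
            have hz : z ∈ Z := ⟨⟨z, hzU⟩, by rw [Set.mem_preimage, h1]; exact t.2, rfl⟩
            exact ⟨⟨z, hz⟩, Prod.ext (Subtype.ext hpz) (Subtype.ext h1)⟩
        exact splitsEquivariantly_succ hsplit (Equiv.ofBijective f hf) hdist
          (fun g z => Subtype.ext (hp g z (hZU z z.2)))
          (fun g z => Subtype.ext (Subtype.ext (hq g z (hZU z z.2))))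

end Products

end CATZero

theorem corollary10 {n : ℕ} (G : Fin n → Type*) [∀ i, Group (G i)]
    (X : Type*) [MetricSpace X] [ProperSpace X] [Nonempty X] (hX : CATZero.IsCATZero X)
    [MulAction (∀ i, G i) X] [IsIsometricSMul (∀ i, G i) X] :
    (∃ ξ : CATZero.Boundary X, ∀ g : ∀ i, G i, g • ξ = ξ) ∨
      ∃ Z : SubMulAction (∀ i, G i) X,
        (Z : Set X).Nonempty ∧ IsClosed (Z : Set X) ∧ CATZero.IsConvex (Z : Set X) ∧
          CATZero.SplitsEquivariantly G Z := by
  exact CATZero.exists_fixedPoint_or_splits G X hX
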